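/- Let $\lambda$ denote Lebesgue measure on $[0,1]$, and let $\mathcal W$ be the set of bounded symmetric functions $W:[0,1]^2\to\mathbb R$ that are measurable with respect to the Lebesgue sets of $[0,1]^2$. Graphs are finite and loopless; a simple graph has no multiple edges, while a multigraph may have them. For a graph or multigraph $F$ with vertex set $\{1,\dots,n\}$ and $W\in\mathcal W$ put $$t(F,W)=\int_{[0,1]^n}\ \prod_{ij\in E(F)}W(x_i,x_j)\,dx_1\cdots dx_n,$$ where each edge is taken with its multiplicity. A map $\varphi:[0,1]\to[0,1]$ is measure preserving if, for every Lebesgue set $A\subseteq[0,1]$, the set $\varphi^{-1}(A)$ is a Lebesgue set with $\lambda(\varphi^{-1}(A))=\lambda(A)$. Write $W^{\varphi}(x,y)=W(\varphi(x),\varphi(y))$. For any two functions $W,W'\in\mathcal W$ the following are equivalent. (a) $t(F,W')=t(F,W)$ for every simple graph $F$. (b) $t(F,W')=t(F,W)$ for every multigraph $F$. (c) There exist a function $U\in\mathcal W$ and two measure preserving maps $\varphi,\psi:[0,1]\to[0,1]$ such that $W=U^{\varphi}$ and $W'=U^{\psi}$ almost everywhere on $[0,1]^2$. (d) There exist two measure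 preserving maps $\varphi,\psi:[0,1]\to[0,1]$ such that $(W')^{\varphi}=W^{\psi}$ almost everywhere on $[0,1]^2$. (e) There exists a probability measure $\gamma$ on $[0,1]\times[0,1]$ such that each marginal of $\gamma$ is $\lambda$ and, if $(X,X')$ and $(Y,Y')$ are two independent samples from $\gamma$, then $W(X,Y)=W'(X',Y')$ with probability $1$. -/

import Mathlib

open MeasureTheory
open scoped unitInterval

noncomputable section

/-- The class of bounded symmetric functions on the unit square that are measurable with respect to
the Lebesgue sets, i.e. the completion of the Borel sets under the product measure
(`NullMeasurable`). These are genuine functions, not classes modulo null sets. -/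
structure SymmKernel where
  toFun : I → I → ℝ
  symm' : ∀ x y, toFun x y = toFun y x
  bounded' : ∃ C : ℝ, ∀ x y, |toFun x y| ≤ C
  measurable' : NullMeasurable (fun p : I × I => toFun p.1 p.2) volume

instance : CoeFun SymmKernel (fun _ => I → I → ℝ) := ⟨SymmKernel.toFun⟩

/-- The pull-back `(x, y) ↦ W (φ x) (φ y)` of a two-variable function along `φ`. -/
def pullback (W : I → I → ℝ) (φ : I → I) : I → I → ℝ := fun x y => W (φ x) (φ y)

/-- Two functions on the unit square are equal almost everywhere. -/
def AEEqSquare (f g : I → I → ℝ) : Prop :=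
  ∀ᵐ p ∂(volume : Measure (I × I)), f p.1 p.2 = g p.1 p.2

/-- A measure preserving self-map of the Lebesgue space `[0,1]`, the completion of the Borel
probability space `[0,1]`: preimages of Lebesgue sets are Lebesgue sets of the same measure. -/
def LebesguePreserving (φ : I → I) : Prop :=
  MeasurePreserving (α := NullMeasurableSpace I volume) (β := NullMeasurableSpace I volume) φ
    (volume : Measure I).completion (volume : Measure I).completion

/-- A multigraph on the vertex set `V`: a finite multiset of unordered pairs; parallel edges
are allowed, loops are not. -/
structure Multigraph (V : Type) where
  edges : Multiset (Sym2 V)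
  loopless : ∀ e ∈ edges, ¬ e.IsDiag

/-- The value `W (x i) (x j)` at the unordered pair `{i, j}`. -/
def SymmKernel.onEdge (W : SymmKernel) {V : Type} (x : V → I) : Sym2 V → ℝ :=
  Sym2.lift ⟨fun i j => W (x i) (x j), fun i j => W.symm' (x i) (x j)⟩

open Classical in
/-- The density of a finite simple graph `F` in `W`. -/
def simpleDensity {V : Type} [Fintype V] (F : SimpleGraph V) (W : SymmKernel) : ℝ :=
  ∫ x : V → I, ∏ e ∈ F.edgeFinset, W.onEdge x e

/-- The density of a finite multigraph `F` in `W`; each edge counts with its multiplicity. -/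
def multiDensity {V : Type} [Fintype V] (F : Multigraph V) (W : SymmKernel) : ℝ :=
  ∫ x : V → I, (F.edges.map (W.onEdge x)).prod

end

open scoped ENNReal
open Filter Topology BoundedContinuousFunction

/-! ### Lebesgue preserving maps and Borel maps -/

theorem MeasureTheory.MeasurePreserving.lebesguePreserving {φ : I → I}
    (h : MeasurePreserving φ volume volume) : LebesguePreserving φ := by
  refine ⟨fun s hs => NullMeasurableSet.preimage hs h.quasiMeasurePreserving, ?_⟩
  let φ' : NullMeasurableSpace I volume → NullMeasurableSpace I volume := φ
  have hm : Measurable φ' :=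
    fun s hs => NullMeasurableSet.preimage hs h.quasiMeasurePreserving
  change Measure.map φ' _ = _
  ext s hs
  rw [Measure.map_apply hm hs]
  have h1 := Measure.completion_apply (volume : Measure I) (φ' ⁻¹' s)
  have h2 := Measure.completion_apply (volume : Measure I) s
  exact h1.trans ((h.measure_preimage hs).trans h2.symm)

theorem LebesguePreserving.exists_measurePreserving {φ : I → I} (h : LebesguePreserving φ) :
    ∃ φ' : I → I, MeasurePreserving φ' volume volume ∧ φ =ᵐ[volume] φ' := by
  have hn : NullMeasurable φ (volume : Measure I) := fun s hs =>
    h.measurable (hs.nullMeasurableSet (μ := (volume : Measure I)))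
  have ha : AEMeasurable φ (volume : Measure I) := hn.aemeasurable
  refine ⟨ha.mk φ, ⟨ha.measurable_mk, ?_⟩, ha.ae_eq_mk⟩
  ext s hs
  rw [Measure.map_apply ha.measurable_mk hs]
  have h1 : volume (ha.mk φ ⁻¹' s) = volume (φ ⁻¹' s) :=
    measure_congr (ha.ae_eq_mk.symm.preimage s)
  have hs' : NullMeasurableSet s (volume : Measure I) := hs.nullMeasurableSet
  have h2 := MeasurePreserving.measure_preimage h (s := s) (MeasurableSet.nullMeasurableSet hs')
  have h3 := Measure.completion_apply (volume : Measure I) (φ ⁻¹' s)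
  have h4 := Measure.completion_apply (volume : Measure I) s
  exact h1.trans (h3.symm.trans (h2.trans h4))

/-! ### Pairs of coordinates in a power of a probability space -/

theorem MeasureTheory.measurePreserving_eval_pair {V Ω : Type*} [Fintype V] [MeasurableSpace Ω]
    (ν : Measure Ω) [IsProbabilityMeasure ν] {i j : V} (hij : i ≠ j) :
    MeasurePreserving (fun z : V → Ω => (z i, z j)) (Measure.pi fun _ => ν) (ν.prod ν) := by
  refine ⟨by fun_prop, ?_⟩
  have hind := (ProbabilityTheory.iIndepFun_pi (μ := fun _ : V => ν) (X := fun _ => id)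
    (fun _ => aemeasurable_id)).indepFun hij
  have := (ProbabilityTheory.indepFun_iff_map_prod_eq_prod_map_map
    (measurable_pi_apply i).aemeasurable (measurable_pi_apply j).aemeasurable).1 hind
  have e (k : V) : Measure.map (fun z : V → Ω => z k) (Measure.pi fun _ => ν) = ν :=
    (measurePreserving_eval (fun _ : V => ν) k).map_eq
  rw [e i, e j] at this
  exact this

/-! ### Densities of equivalent kernels -/

theorem SymmKernel.aemeasurable (W : SymmKernel) :
    AEMeasurable (fun p : I × I => W p.1 p.2) volume :=
  W.measurable'.aemeasurable

theorem SymmKernel.aemeasurable_onEdge (W : SymmKernel) {V : Type} [Fintype V] {e : Sym2 V}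
    (he : ¬ e.IsDiag) : AEMeasurable (fun x : V → I => W.onEdge x e) volume := by
  induction e with
  | h i j =>
    have hij : i ≠ j := he
    exact W.aemeasurable.comp_quasiMeasurePreserving
      (measurePreserving_eval_pair (volume : Measure I) hij).quasiMeasurePreserving

theorem multiDensity_eq_integral_comp {Ω V : Type} [Fintype V] [MeasurableSpace Ω]
    {ν : Measure Ω} [IsProbabilityMeasure ν] {X : Ω → I} (hX : MeasurePreserving X ν volume)
    (F : Multigraph V) (W : SymmKernel) :
    multiDensity F W =
      ∫ z : V → Ω, (F.edges.map (W.onEdge fun i => X (z i))).prod ∂(Measure.pi fun _ => ν) := by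
  have hpi := measurePreserving_pi (fun _ : V => ν) (fun _ : V => (volume : Measure I))
    (f := fun _ => X) (fun _ => hX)
  have hm : ∀ s : Multiset (Sym2 V), (∀ e ∈ s, ¬ e.IsDiag) →
      AEMeasurable (fun x : V → I => (s.map (W.onEdge x)).prod) volume := by
    intro s
    induction s using Multiset.induction with
    | empty => intro _; simp
    | cons e s ih =>
      intro hs
      simp only [Multiset.map_cons, Multiset.prod_cons]
      exact (W.aemeasurable_onEdge (hs e (by simp))).mul
        (ih fun e he => hs e (Multiset.mem_cons_of_mem he))
  have hm' := hm F.edges F.loopless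
  rw [multiDensity]
  change ∫ x, _ ∂(Measure.pi fun _ : V => (volume : Measure I)) = _
  rw [← hpi.map_eq, integral_map hpi.aemeasurable]
  rw [hpi.map_eq]
  exact hm'.aestronglyMeasurable

theorem multiDensity_eq_of_coupling {Ω V : Type} [Fintype V] [MeasurableSpace Ω]
    {ν : Measure Ω} [IsProbabilityMeasure ν] {X Y : Ω → I} (hX : MeasurePreserving X ν volume)
    (hY : MeasurePreserving Y ν volume) {W W' : SymmKernel}
    (h : ∀ᵐ p ∂(ν.prod ν), W (X p.1) (X p.2) = W' (Y p.1) (Y p.2)) (F : Multigraph V) :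
    multiDensity F W = multiDensity F W' := by
  rw [multiDensity_eq_integral_comp hX, multiDensity_eq_integral_comp hY]
  refine integral_congr_ae ?_
  have key : ∀ e ∈ F.edges, ∀ᵐ z ∂(Measure.pi fun _ : V => ν),
      W.onEdge (fun i => X (z i)) e = W'.onEdge (fun i => Y (z i)) e := by
    intro e he
    have hd := F.loopless e he
    induction e with
    | h i j =>
      exact (measurePreserving_eval_pair ν (show i ≠ j from hd)).quasiMeasurePreserving.ae h
  have : ∀ᵐ z ∂(Measure.pi fun _ : V => ν), ∀ e ∈ F.edges,
      W.onEdge (fun i => X (z i)) e = W'.onEdge (fun i => Y (z i)) e := by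
    classical
    have := (Filter.eventually_all_finset F.edges.toFinset).2
      (fun e he => key e (Multiset.mem_toFinset.1 he))
    filter_upwards [this] with z hz e he using hz e (Multiset.mem_toFinset.2 he)
  filter_upwards [this] with z hz
  exact congrArg _ (Multiset.map_congr rfl hz)

theorem simpleDensity_eq_multiDensity {V : Type} [Fintype V] (F : SimpleGraph V) :
    ∃ F' : Multigraph V, ∀ W : SymmKernel, simpleDensity F W = multiDensity F' W := by
  classical
  refine ⟨⟨F.edgeFinset.val, fun e he => F.not_isDiag_of_mem_edgeSet (by simpa using he)⟩, ?_⟩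
  intro W
  rfl

theorem ae_square_of_ae {φ φ' : I → I} (h : φ =ᵐ[volume] φ') :
    ∀ᵐ p ∂(volume : Measure (I × I)), φ p.1 = φ' p.1 ∧ φ p.2 = φ' p.2 :=
  (Measure.quasiMeasurePreserving_fst.ae h).and (Measure.quasiMeasurePreserving_snd.ae h)

/-! ### Borel representatives -/

theorem SymmKernel.exists_borel (W : SymmKernel) {C : ℝ} (hC : ∀ x y, |W x y| ≤ C) :
    ∃ V : SymmKernel, Measurable (fun p : I × I => V p.1 p.2) ∧ (∀ x y, |V x y| ≤ C) ∧
      AEEqSquare W V := by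
  have hC0 : 0 ≤ C := (abs_nonneg _).trans (hC 0 0)
  set g := W.aemeasurable.mk _ with hg
  have hgm : Measurable g := W.aemeasurable.measurable_mk
  have hge : ∀ᵐ p ∂(volume : Measure (I × I)), W p.1 p.2 = g p := W.aemeasurable.ae_eq_mk
  let f : I → I → ℝ := fun x y => max (-C) (min C ((g (x, y) + g (y, x)) / 2))
  have hfm : Measurable (fun p : I × I => f p.1 p.2) := by
    have h2 : Measurable fun p : I × I => g (p.2, p.1) := hgm.comp measurable_swap
    have h1 : Measurable fun p : I × I => g (p.1, p.2) := hgm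
    exact measurable_const.max (measurable_const.min ((h1.add h2).div_const 2))
  have hfb : ∀ x y, |f x y| ≤ C := fun x y => abs_le.2
    ⟨le_max_left _ _, max_le (by linarith) (min_le_left _ _)⟩
  refine ⟨⟨f, fun x y => by simp only [f, add_comm], ⟨C, hfb⟩, hfm.nullMeasurable⟩, hfm, hfb, ?_⟩
  have hswap : ∀ᵐ p ∂(volume : Measure (I × I)), W p.2 p.1 = g (p.2, p.1) :=
    (Measure.measurePreserving_swap (μ := (volume : Measure I))
      (ν := (volume : Measure I))).quasiMeasurePreserving.ae hge
  unfold AEEqSquare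
  filter_upwards [hge, hswap] with p h1 h2
  have hb := abs_le.1 (hC p.1 p.2)
  have h3 : g (p.1, p.2) = W p.1 p.2 := h1.symm
  change _ = max (-C) (min C ((g (p.1, p.2) + g (p.2, p.1)) / 2))
  rw [h3, ← h2, W.symm' p.2 p.1, min_eq_right (by linarith), max_eq_right (by linarith)]
  ring

/-! ### Independent random signs with prescribed means -/

/-- The real sign attached to a Boolean. -/
def boolSign (b : Bool) : ℝ := if b then 1 else -1

theorem boolSign_not (b : Bool) : boolSign (!b) = -boolSign b := by
  cases b <;> simp [boolSign]

theorem abs_boolSign (b : Bool) : |boolSign b| = 1 := by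
  cases b <;> simp [boolSign]

section Signs

variable {E : Type*} [Fintype E]

/-- The probability of the sign pattern `ε` if the signs are independent with means `v`. -/
noncomputable def signWeight (v : E → ℝ) (ε : E → Bool) : ℝ := ∏ e, (1 + boolSign (ε e) * v e) / 2

theorem signWeight_nonneg {v : E → ℝ} (hv : ∀ e, |v e| ≤ 1) (ε : E → Bool) :
    0 ≤ signWeight v ε := by
  refine Finset.prod_nonneg fun e _ => ?_
  have h := abs_le.1 (hv e)
  cases ε e <;> simp only [boolSign] <;> norm_num <;> linarith

theorem sum_signWeight [DecidableEq E] (v : E → ℝ) : ∑ ε, signWeight v ε = 1 := by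
  have := Finset.prod_univ_sum (fun _ : E => (Finset.univ : Finset Bool))
    (fun e b => (1 + boolSign b * v e) / 2)
  rw [Fintype.piFinset_univ] at this
  simp only [signWeight]
  rw [← this]
  refine Finset.prod_eq_one fun e _ => ?_
  simp [boolSign]
  ring

theorem sum_signWeight_mul_eq_zero [DecidableEq E] (v : E → ℝ) (e : E) (g : (E → Bool) → ℝ)
    (hg : ∀ ε b, g (Function.update ε e b) = g ε) :
    ∑ ε, signWeight v ε * ((boolSign (ε e) - v e) * g ε) = 0 := by
  have hinv : Function.Involutive fun ε : E → Bool => Function.update ε e (!ε e) := by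
    intro ε
    simp
  have hflip := Equiv.sum_comp hinv.toPerm
    (fun ε => signWeight v ε * ((boolSign (ε e) - v e) * g ε))
  have hneg : ∀ ε : E → Bool, signWeight v (Function.update ε e (!ε e)) *
      ((boolSign (Function.update ε e (!ε e) e) - v e) * g (Function.update ε e (!ε e))) =
      -(signWeight v ε * ((boolSign (ε e) - v e) * g ε)) := by
    intro ε
    have h1 : ∀ ε' : E → Bool, signWeight v ε' = (1 + boolSign (ε' e) * v e) / 2 *
        ∏ e' ∈ Finset.univ.erase e, (1 + boolSign (ε' e') * v e') / 2 := fun ε' =>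
      (Finset.mul_prod_erase _ _ (Finset.mem_univ e)).symm
    have h2 : ∏ e' ∈ Finset.univ.erase e,
        (1 + boolSign (Function.update ε e (!ε e) e') * v e') / 2 =
        ∏ e' ∈ Finset.univ.erase e, (1 + boolSign (ε e') * v e') / 2 :=
      Finset.prod_congr rfl fun e' he' => by
        rw [Function.update_of_ne (Finset.ne_of_mem_erase he')]
    rw [h1, h1 ε, h2, hg, Function.update_self, boolSign_not]
    cases ε e <;> simp [boolSign] <;> ring
  have : ∑ ε, signWeight v ε * ((boolSign (ε e) - v e) * g ε) =
      -∑ ε, signWeight v ε * ((boolSign (ε e) - v e) * g ε) := by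
    rw [← Finset.sum_neg_distrib]
    exact hflip.symm.trans (Finset.sum_congr rfl fun ε _ => hneg ε)
  linarith

end Signs

/-! ### The four-cycle sum of a matrix -/

/-- The sum of `d` over the homomorphic images of a four-cycle. -/
def fourCycleSum {n : ℕ} (d : Sym2 (Fin n) → ℝ) : ℝ :=
  ∑ j, ∑ k, (∑ i, d s(i, j) * d s(i, k)) ^ 2

theorem fourCycleSum_nonneg {n : ℕ} (d : Sym2 (Fin n) → ℝ) : 0 ≤ fourCycleSum d :=
  Finset.sum_nonneg fun _ _ => Finset.sum_nonneg fun _ _ => sq_nonneg _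

theorem fourCycleSum_eq {n : ℕ} (d : Sym2 (Fin n) → ℝ) : fourCycleSum d =
    ∑ j, ∑ k, ∑ i, ∑ i', d s(i, j) * d s(i, k) * (d s(i', j) * d s(i', k)) := by
  simp only [fourCycleSum, sq, Finset.sum_mul_sum]

theorem bilinear_pow_four_le {n : ℕ} (d : Sym2 (Fin n) → ℝ) {f g : Fin n → ℝ} {A B : ℝ}
    (hf : ∀ i, |f i| ≤ A) (hg : ∀ i, |g i| ≤ B) :
    (∑ i, ∑ j, f i * g j * d s(i, j)) ^ 4 ≤ (A * B) ^ 4 * (n : ℝ) ^ 4 * fourCycleSum d := by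
  have hf2 : ∑ i, f i ^ 2 ≤ n * A ^ 2 := by
    calc ∑ i, f i ^ 2 ≤ ∑ _i : Fin n, A ^ 2 := Finset.sum_le_sum fun i _ =>
          sq_le_sq' (abs_le.1 (hf i)).1 (abs_le.1 (hf i)).2
      _ = n * A ^ 2 := by simp
  have hg2 : ∑ j, ∑ k, (g j * g k) ^ 2 ≤ (n : ℝ) ^ 2 * B ^ 4 := by
    calc ∑ j, ∑ k, (g j * g k) ^ 2 ≤ ∑ _j : Fin n, ∑ _k : Fin n, B ^ 4 := by
          refine Finset.sum_le_sum fun j _ => Finset.sum_le_sum fun k _ => ?_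
          have h1 := sq_le_sq' (abs_le.1 (hg j)).1 (abs_le.1 (hg j)).2
          have h2 := sq_le_sq' (abs_le.1 (hg k)).1 (abs_le.1 (hg k)).2
          calc (g j * g k) ^ 2 = g j ^ 2 * g k ^ 2 := by ring
            _ ≤ B ^ 2 * B ^ 2 := mul_le_mul h1 h2 (sq_nonneg _) (sq_nonneg _)
            _ = B ^ 4 := by ring
      _ = (n : ℝ) ^ 2 * B ^ 4 := by simp; ring
  set R := ∑ i, (∑ j, g j * d s(i, j)) ^ 2 with hR
  have hR0 : 0 ≤ R := Finset.sum_nonneg fun _ _ => sq_nonneg _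
  have h1 : (∑ i, ∑ j, f i * g j * d s(i, j)) ^ 2 ≤ n * A ^ 2 * R := by
    have e : ∑ i, ∑ j, f i * g j * d s(i, j) = ∑ i, f i * ∑ j, g j * d s(i, j) := by
      simp only [Finset.mul_sum, mul_assoc]
    rw [e]
    exact (Finset.sum_mul_sq_le_sq_mul_sq _ _ _).trans (mul_le_mul_of_nonneg_right hf2 hR0)
  have h2 : R = ∑ j, ∑ k, (g j * g k) * ∑ i, d s(i, j) * d s(i, k) := by
    simp only [hR, sq, Finset.sum_mul_sum]
    simp only [Finset.mul_sum]
    rw [Finset.sum_comm]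
    refine Finset.sum_congr rfl fun j _ => ?_
    rw [Finset.sum_comm]
    refine Finset.sum_congr rfl fun k _ => Finset.sum_congr rfl fun i _ => by ring
  have h3 : R ^ 2 ≤ (n : ℝ) ^ 2 * B ^ 4 * fourCycleSum d := by
    have := Finset.sum_mul_sq_le_sq_mul_sq (Finset.univ : Finset (Fin n × Fin n))
      (fun p => g p.1 * g p.2) (fun p => ∑ i, d s(i, p.1) * d s(i, p.2))
    simp only [Fintype.sum_prod_type] at this
    rw [h2]
    exact this.trans (mul_le_mul_of_nonneg_right hg2 (fourCycleSum_nonneg d))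
  calc (∑ i, ∑ j, f i * g j * d s(i, j)) ^ 4
      = ((∑ i, ∑ j, f i * g j * d s(i, j)) ^ 2) ^ 2 := by ring
    _ ≤ (n * A ^ 2 * R) ^ 2 := pow_le_pow_left₀ (sq_nonneg _) h1 2
    _ = (n : ℝ) ^ 2 * A ^ 4 * R ^ 2 := by ring
    _ ≤ (n : ℝ) ^ 2 * A ^ 4 * ((n : ℝ) ^ 2 * B ^ 4 * fourCycleSum d) := by gcongr
    _ = (A * B) ^ 4 * (n : ℝ) ^ 4 * fourCycleSum d := by ring

theorem sum_signWeight_mul_fourCycleSum_le {n : ℕ} {v : Sym2 (Fin n) → ℝ} (hv : ∀ e, |v e| ≤ 1) :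
    ∑ ε, signWeight v ε * fourCycleSum (fun e => boolSign (ε e) - v e) ≤ 32 * (n : ℝ) ^ 3 := by
  set t : Fin n → Fin n → Fin n → Fin n → ℝ := fun j k i i' => ∑ ε, signWeight v ε *
    ((boolSign (ε s(i, j)) - v s(i, j)) * (boolSign (ε s(i, k)) - v s(i, k)) *
      ((boolSign (ε s(i', j)) - v s(i', j)) * (boolSign (ε s(i', k)) - v s(i', k)))) with ht
  have h0 : ∑ ε, signWeight v ε * fourCycleSum (fun e => boolSign (ε e) - v e) =
      ∑ j, ∑ k, ∑ i, ∑ i', t j k i i' := by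
    simp only [fourCycleSum_eq, Finset.mul_sum, ht]
    rw [Finset.sum_comm]
    refine Finset.sum_congr rfl fun j _ => ?_
    rw [Finset.sum_comm]
    refine Finset.sum_congr rfl fun k _ => ?_
    rw [Finset.sum_comm]
    refine Finset.sum_congr rfl fun i _ => ?_
    rw [Finset.sum_comm]
  have hd : ∀ (ε : Sym2 (Fin n) → Bool) e, |boolSign (ε e) - v e| ≤ 2 := fun ε e =>
    (abs_sub _ _).trans (by rw [abs_boolSign]; linarith [hv e])
  have hle : ∀ j k i i', t j k i i' ≤ 16 := by
    intro j k i i'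
    calc t j k i i' ≤ ∑ ε, signWeight v ε * 16 := by
          refine Finset.sum_le_sum fun ε _ =>
            mul_le_mul_of_nonneg_left ?_ (signWeight_nonneg hv ε)
          refine (le_abs_self _).trans ?_
          simp only [abs_mul]
          calc _ ≤ (2 * 2 * (2 * 2) : ℝ) := by gcongr <;> exact hd _ _
            _ = 16 := by norm_num
      _ = 16 := by rw [← Finset.sum_mul, sum_signWeight, one_mul]
  have hzero : ∀ j k i i', j ≠ k → i ≠ i' → t j k i i' = 0 := by
    intro j k i i' hjk hii
    by_cases hc : i = k ∧ i' = j
    · have := sum_signWeight_mul_eq_zero v s(i, k) (fun ε =>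
        (boolSign (ε s(i, j)) - v s(i, j)) * ((boolSign (ε s(i', j)) - v s(i', j)) *
          (boolSign (ε s(i', k)) - v s(i', k)))) (by
          intro ε b
          obtain ⟨rfl, rfl⟩ := hc
          rw [Function.update_of_ne, Function.update_of_ne, Function.update_of_ne] <;>
          · simp only [ne_eq, Sym2.eq_iff]
            tauto)
      rw [← this]
      exact Finset.sum_congr rfl fun ε _ => by ring
    · have := sum_signWeight_mul_eq_zero v s(i, j) (fun ε =>
        (boolSign (ε s(i, k)) - v s(i, k)) * ((boolSign (ε s(i', j)) - v s(i', j)) *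
          (boolSign (ε s(i', k)) - v s(i', k)))) (by
          intro ε b
          rw [Function.update_of_ne, Function.update_of_ne, Function.update_of_ne] <;>
          · simp only [ne_eq, Sym2.eq_iff]
            grind)
      rw [← this]
      exact Finset.sum_congr rfl fun ε _ => by ring
  have hpt : ∀ j k i i', t j k i i' ≤ (if j = k then 16 else 0) + (if i = i' then 16 else 0) := by
    intro j k i i'
    have := hle j k i i'
    by_cases h1 : j = k <;> by_cases h2 : i = i'
    · simp only [h1, h2, if_true] at *; linarith
    · simp only [h1, h2, if_true, if_false] at *; linarith
    · simp only [h1, h2, if_true, if_false] at *; linarith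
    · rw [hzero j k i i' h1 h2]; simp [h1, h2]
  rw [h0]
  calc ∑ j, ∑ k, ∑ i, ∑ i', t j k i i'
      ≤ ∑ j : Fin n, ∑ k : Fin n, ∑ i : Fin n, ∑ i' : Fin n,
        (((if j = k then 16 else 0) + (if i = i' then 16 else 0) : ℝ)) :=
        Finset.sum_le_sum fun j _ => Finset.sum_le_sum fun k _ => Finset.sum_le_sum fun i _ =>
          Finset.sum_le_sum fun i' _ => hpt j k i i'
    _ = 32 * (n : ℝ) ^ 3 := by
        simp [Finset.sum_add_distrib]
        ring

/-! ### Sampling a kernel at finitely many points -/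

/-- The values of `W` at the pairs of distinct sample points, and `0` on the diagonal. -/
noncomputable def SymmKernel.sample (W : SymmKernel) {n : ℕ} (x : Fin n → I) (e : Sym2 (Fin n)) :
    ℝ :=
  if e.IsDiag then 0 else W.onEdge x e

theorem SymmKernel.sample_mk_of_ne (W : SymmKernel) {n : ℕ} (x : Fin n → I) {i j : Fin n}
    (hij : i ≠ j) : W.sample x s(i, j) = W (x i) (x j) :=
  if_neg hij

theorem SymmKernel.abs_sample_le {W : SymmKernel} (hb : ∀ x y, |W x y| ≤ 1) {n : ℕ}
    (x : Fin n → I) (e : Sym2 (Fin n)) : |W.sample x e| ≤ 1 := by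
  unfold SymmKernel.sample
  split_ifs
  · simp
  · induction e with
    | h i j => exact hb _ _

theorem SymmKernel.measurable_sample {W : SymmKernel}
    (hm : Measurable fun p : I × I => W p.1 p.2) {n : ℕ} (e : Sym2 (Fin n)) :
    Measurable fun x : Fin n → I => W.sample x e := by
  unfold SymmKernel.sample
  split_ifs
  · exact measurable_const
  · induction e with
    | h i j =>
      exact hm.comp (g := fun p : I × I => W p.1 p.2) (f := fun x : Fin n → I => (x i, x j))
        ((measurable_pi_apply i).prodMk (measurable_pi_apply j))

theorem measurable_signWeight_sample {W : SymmKernel}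
    (hm : Measurable fun p : I × I => W p.1 p.2) {n : ℕ} (ε : Sym2 (Fin n) → Bool) :
    Measurable fun x : Fin n → I => signWeight (W.sample x) ε :=
  Finset.measurable_prod _ fun e _ =>
    ((measurable_const.add ((W.measurable_sample hm e).const_mul _)).div_const _)

theorem integral_prod_sample_eq {W W' : SymmKernel}
    (h : ∀ (n : ℕ) (F : SimpleGraph (Fin n)), simpleDensity F W' = simpleDensity F W)
    {n : ℕ} (t : Finset (Sym2 (Fin n))) :
    ∫ x : Fin n → I, ∏ e ∈ t, W.sample x e = ∫ x : Fin n → I, ∏ e ∈ t, W'.sample x e := by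
  classical
  by_cases ht : ∃ e ∈ t, e.IsDiag
  · obtain ⟨e, het, he⟩ := ht
    have h0 : ∀ (U : SymmKernel) (x : Fin n → I), ∏ e ∈ t, U.sample x e = 0 := fun U x =>
      Finset.prod_eq_zero het (if_pos he)
    simp only [h0]
  · push Not at ht
    have h1 : ∀ (U : SymmKernel), simpleDensity (SimpleGraph.fromEdgeSet (t : Set (Sym2 (Fin n)))) U
        = ∫ x : Fin n → I, ∏ e ∈ t, U.sample x e := by
      intro U
      unfold simpleDensity
      congr 1
      funext x
      refine Finset.prod_congr ?_ ?_
      · ext e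
        simp only [SimpleGraph.mem_edgeFinset, SimpleGraph.edgeSet_fromEdgeSet, Set.mem_sdiff,
          Finset.mem_coe]
        exact ⟨fun h => h.1, fun h => ⟨h, ht e h⟩⟩
      · intro e he
        exact (if_neg (ht e he)).symm
    rw [← h1, ← h1, h]

theorem integral_signWeight_sample_eq {W W' : SymmKernel}
    (hm : Measurable fun p : I × I => W p.1 p.2) (hm' : Measurable fun p : I × I => W' p.1 p.2)
    (hb : ∀ x y, |W x y| ≤ 1) (hb' : ∀ x y, |W' x y| ≤ 1)
    (h : ∀ (n : ℕ) (F : SimpleGraph (Fin n)), simpleDensity F W' = simpleDensity F W)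
    {n : ℕ} (ε : Sym2 (Fin n) → Bool) :
    ∫ x : Fin n → I, signWeight (W.sample x) ε = ∫ x : Fin n → I, signWeight (W'.sample x) ε := by
  classical
  have key : ∀ U : SymmKernel, (Measurable fun p : I × I => U p.1 p.2) → (∀ x y, |U x y| ≤ 1) →
      ∫ x : Fin n → I, signWeight (U.sample x) ε =
        ∑ t : Finset (Sym2 (Fin n)), ((∏ e ∈ t, boolSign (ε e) / 2) *
          ∏ e ∈ Finset.univ \ t, (1 / 2 : ℝ)) * ∫ x : Fin n → I, ∏ e ∈ t, U.sample x e := by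
    intro U hU hUb
    have e1 : ∀ x : Fin n → I, signWeight (U.sample x) ε =
        ∑ t : Finset (Sym2 (Fin n)), ((∏ e ∈ t, boolSign (ε e) / 2) *
          ∏ e ∈ Finset.univ \ t, (1 / 2 : ℝ)) * ∏ e ∈ t, U.sample x e := by
      intro x
      have : signWeight (U.sample x) ε =
          ∏ e, (boolSign (ε e) / 2 * U.sample x e + 1 / 2) :=
        Finset.prod_congr rfl fun e _ => by ring
      rw [this, Finset.prod_add, Finset.powerset_univ]
      refine Finset.sum_congr rfl fun t _ => ?_
      rw [Finset.prod_mul_distrib]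
      ring
    simp only [e1]
    rw [integral_finsetSum]
    · simp only [integral_const_mul]
    · intro t _
      refine Integrable.const_mul ?_ _
      refine Integrable.of_bound (C := 1) (Finset.measurable_prod _ fun e _ =>
        U.measurable_sample hU e).aestronglyMeasurable (ae_of_all _ fun x => ?_)
      rw [Real.norm_eq_abs, Finset.abs_prod]
      exact Finset.prod_le_one (fun _ _ => abs_nonneg _) fun e _ => U.abs_sample_le hUb x e
  rw [key W hm hb, key W' hm' hb']
  simp only [integral_prod_sample_eq h]

/-! ### Laws of large numbers -/

theorem lintegral_sq_average_sub_le {n : ℕ} (hn : 0 < n) (f : C(I, ℝ)) :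
    ∫⁻ x : Fin n → I, ENNReal.ofReal (((∑ i, f (x i)) / n - ∫ t, f t) ^ 2) ≤
      ENNReal.ofReal (‖f‖ ^ 2 / n) := by
  have hn' : (0 : ℝ) < n := by exact_mod_cast hn
  have hf : MemLp (fun t : I => f t) 2 volume :=
    MemLp.of_bound f.continuous.aestronglyMeasurable ‖f‖ (ae_of_all _ f.norm_coe_le_norm)
  have hfint : Integrable (fun t : I => f t) volume := hf.integrable (by norm_num)
  have hvar := ProbabilityTheory.variance_sum_pi (μ := fun _ : Fin n => (volume : Measure I))
    (X := fun _ t => f t) (fun _ => hf)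
  have hX : (∑ i : Fin n, fun ω : Fin n → I => f (ω i)) = fun ω => ∑ i, f (ω i) := by
    ext ω; simp
  have hmean : ∫ x : Fin n → I, ∑ i, f (x i) = n * ∫ t, f t := by
    rw [integral_finsetSum]
    · have : ∀ i : Fin n, ∫ x : Fin n → I, f (x i) = ∫ t, f t := fun i => by
        have hmp := measurePreserving_eval (fun _ : Fin n => (volume : Measure I)) i
        have := integral_map (μ := Measure.pi fun _ : Fin n => (volume : Measure I))
          hmp.aemeasurable (f := fun t => f t) (by
            rw [hmp.map_eq]; exact f.continuous.aestronglyMeasurable)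
        rw [hmp.map_eq] at this
        exact this.symm
      simp [this]
    · intro i _
      exact (measurePreserving_eval (fun _ : Fin n => (volume : Measure I)) i).integrable_comp_of_integrable hfint
  have hXm : Continuous fun ω : Fin n → I => ∑ i, f (ω i) := by fun_prop
  rw [hX, ProbabilityTheory.variance_eq_integral hXm.aemeasurable] at hvar
  have hv1 : ProbabilityTheory.variance (fun t : I => f t) volume ≤ ‖f‖ ^ 2 := by
    refine (ProbabilityTheory.variance_le_expectation_sq f.continuous.aestronglyMeasurable).trans ?_
    calc _ ≤ ∫ _ : I, ‖f‖ ^ 2 := by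
          refine integral_mono_of_nonneg (ae_of_all _ fun t => sq_nonneg _) (integrable_const _)
            (ae_of_all _ fun t => ?_)
          exact sq_le_sq' (abs_le.1 (f.norm_coe_le_norm t)).1 (abs_le.1 (f.norm_coe_le_norm t)).2
      _ = ‖f‖ ^ 2 := by simp
  have hcont : Continuous fun x : Fin n → I => ((∑ i, f (x i)) / n - ∫ t, f t) ^ 2 := by fun_prop
  have hint : Integrable (fun x : Fin n → I => ((∑ i, f (x i)) / n - ∫ t, f t) ^ 2) :=
    hcont.integrable_of_hasCompactSupport (HasCompactSupport.of_compactSpace _)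
  rw [← ofReal_integral_eq_lintegral_ofReal hint (ae_of_all _ fun _ => sq_nonneg _)]
  refine ENNReal.ofReal_le_ofReal ?_
  have e : ∀ x : Fin n → I, ((∑ i, f (x i)) / n - ∫ t, f t) ^ 2 =
      (1 / (n : ℝ) ^ 2) * ((∑ i, f (x i)) - n * ∫ t, f t) ^ 2 := by
    intro x; field_simp
  simp only [e]
  rw [integral_const_mul]
  have hvar' : ∫ x : Fin n → I, ((∑ i, f (x i)) - n * ∫ t, f t) ^ 2 ≤ n * ‖f‖ ^ 2 := by
    rw [← hmean]
    refine hvar.le.trans ?_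
    simp only [Finset.sum_const, Finset.card_univ, Fintype.card_fin, nsmul_eq_mul]
    gcongr
  calc _ ≤ (1 / (n : ℝ) ^ 2) * (n * ‖f‖ ^ 2) := by gcongr
    _ = ‖f‖ ^ 2 / n := by field_simp

/-- The sum of `h` over the ordered pairs of distinct sample points. -/
noncomputable def offDiagSum {n : ℕ} (h : I × I → ℝ≥0∞) (x : Fin n → I) : ℝ≥0∞ :=
  ∑ i, ∑ j, if i = j then 0 else h (x i, x j)

theorem measurable_offDiagSum {n : ℕ} {h : I × I → ℝ≥0∞} (hh : Measurable h) :
    Measurable (offDiagSum h : (Fin n → I) → ℝ≥0∞) := by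
  refine Finset.measurable_sum _ fun i _ => Finset.measurable_sum _ fun j _ => ?_
  split_ifs
  · exact measurable_const
  · exact hh.comp ((measurable_pi_apply i).prodMk (measurable_pi_apply j))

theorem lintegral_offDiagSum_le {n : ℕ} {h : I × I → ℝ≥0∞} (hh : Measurable h) :
    ∫⁻ x : Fin n → I, offDiagSum h x ≤ n ^ 2 * ∫⁻ p, h p := by
  have hm : ∀ i j : Fin n,
      Measurable fun x : Fin n → I => if i = j then 0 else h (x i, x j) := by
    intro i j
    split_ifs
    · exact measurable_const
    · exact hh.comp ((measurable_pi_apply i).prodMk (measurable_pi_apply j))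
  unfold offDiagSum
  rw [lintegral_finsetSum _ fun i _ => Finset.measurable_sum _ fun j _ => hm i j]
  calc _ ≤ ∑ _i : Fin n, ∑ _j : Fin n, ∫⁻ p, h p := by
        refine Finset.sum_le_sum fun i _ => ?_
        rw [lintegral_finsetSum _ fun j _ => hm i j]
        refine Finset.sum_le_sum fun j _ => ?_
        split_ifs with hij
        · simp
        · exact ((measurePreserving_eval_pair (volume : Measure I) hij).lintegral_comp hh).le
    _ = n ^ 2 * ∫⁻ p, h p := by
        simp [sq, mul_assoc]

/-! ### Selecting samples with the same signs -/

theorem exists_common_of_lintegral_lt {ι Ω Ω' : Type*} [Fintype ι] [MeasurableSpace Ω]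
    [MeasurableSpace Ω'] {μ : Measure Ω} {μ' : Measure Ω'} {w Φ : ι → Ω → ℝ≥0∞}
    {w' Φ' : ι → Ω' → ℝ≥0∞} (heq : ∀ a, ∫⁻ x, w a x ∂μ = ∫⁻ y, w' a y ∂μ')
    (hlt : ∑ a, ∫⁻ x, w a x * Φ a x ∂μ + ∑ a, ∫⁻ y, w' a y * Φ' a y ∂μ' <
      ∑ a, ∫⁻ x, w a x ∂μ) :
    ∃ a x y, Φ a x < 1 ∧ Φ' a y < 1 := by
  by_contra hcon
  push Not at hcon
  refine hlt.not_ge ?_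
  rw [← Finset.sum_add_distrib]
  refine Finset.sum_le_sum fun a _ => ?_
  by_cases ha : ∃ x, Φ a x < 1
  · obtain ⟨x, hx⟩ := ha
    rw [heq]
    exact le_add_left (lintegral_mono fun y => le_mul_of_one_le_right' (hcon a x y hx))
  · push Not at ha
    exact le_add_right (lintegral_mono fun x => le_mul_of_one_le_right' (ha x))

/-- A sample `x` with signs `ε` is typical for `W` if its empirical measure is `δ`-close to the
uniform measure on the test functions in `S`, the average of `h` over pairs is bounded, and the
signs are close to `W` in cut norm. -/
structure IsTypicalSample (S : Finset C(I, ℝ)) (δ : ℝ) (h : I × I → ℝ≥0∞) (W : SymmKernel) {n : ℕ}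
    (ε : Sym2 (Fin n) → Bool) (x : Fin n → I) : Prop where
  average : ∀ f ∈ S, |(∑ i, f (x i)) / n - ∫ t, f t| ≤ δ
  offDiag : offDiagSum h x ≤ 16 * n ^ 2
  cut : fourCycleSum (fun e => boolSign (ε e) - W.sample x e) ≤ δ * n ^ 4

/-- A function of the sample that is smaller than `1` only at typical samples. -/
noncomputable def samplePenalty (S : Finset C(I, ℝ)) (δ : ℝ) (h : I × I → ℝ≥0∞) (W : SymmKernel)
    {n : ℕ} (ε : Sym2 (Fin n) → Bool) (x : Fin n → I) : ℝ≥0∞ :=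
  ∑ f ∈ S, ENNReal.ofReal (1 / δ ^ 2) * ENNReal.ofReal (((∑ i, f (x i)) / n - ∫ t, f t) ^ 2) +
    (16 * (n : ℝ≥0∞) ^ 2)⁻¹ * offDiagSum h x +
    ENNReal.ofReal (1 / (δ * n ^ 4)) *
      ENNReal.ofReal (fourCycleSum fun e => boolSign (ε e) - W.sample x e)

theorem isTypicalSample_of_samplePenalty_lt_one {S : Finset C(I, ℝ)} {δ : ℝ} (hδ : 0 < δ)
    {h : I × I → ℝ≥0∞} {W : SymmKernel} {n : ℕ} (hn : 0 < n) {ε : Sym2 (Fin n) → Bool}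
    {x : Fin n → I} (hlt : samplePenalty S δ h W ε x < 1) : IsTypicalSample S δ h W ε x := by
  have hn' : (0 : ℝ) < n := by exact_mod_cast hn
  unfold samplePenalty at hlt
  have h12 := lt_of_le_of_lt le_self_add hlt
  have h1 := lt_of_le_of_lt le_self_add h12
  have h2 := lt_of_le_of_lt le_add_self h12
  have h3 := lt_of_le_of_lt le_add_self hlt
  refine ⟨fun f hf => ?_, ?_, ?_⟩
  · have h4 := lt_of_le_of_lt (Finset.single_le_sum (f := fun f : C(I, ℝ) =>
      ENNReal.ofReal (1 / δ ^ 2) * ENNReal.ofReal (((∑ i, f (x i)) / n - ∫ t, f t) ^ 2))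
      (fun _ _ => zero_le) hf) h1
    rw [← ENNReal.ofReal_mul (by positivity), ENNReal.ofReal_lt_one, div_mul_eq_mul_div, one_mul,
      div_lt_one (by positivity)] at h4
    exact (abs_lt_of_sq_lt_sq h4 hδ.le).le
  · have h0 : (16 * (n : ℝ≥0∞) ^ 2) ≠ 0 := by
      simp [hn.ne']
    have ht : (16 * (n : ℝ≥0∞) ^ 2) ≠ ∞ :=
      ENNReal.mul_ne_top (by simp) (ENNReal.pow_ne_top (ENNReal.natCast_ne_top n))
    rw [mul_comm, ← div_eq_mul_inv] at h2
    have := (ENNReal.div_le_iff h0 ht).1 h2.le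
    simpa using this
  · rw [← ENNReal.ofReal_mul (by positivity), ENNReal.ofReal_lt_one, div_mul_eq_mul_div, one_mul,
      div_lt_one (by positivity)] at h3
    exact h3.le

theorem sum_ofReal_signWeight_sample {W : SymmKernel} (hb : ∀ x y, |W x y| ≤ 1) {n : ℕ}
    (x : Fin n → I) : ∑ ε, ENNReal.ofReal (signWeight (W.sample x) ε) = 1 := by
  rw [← ENNReal.ofReal_sum_of_nonneg fun ε _ => signWeight_nonneg (W.abs_sample_le hb x) ε,
    sum_signWeight, ENNReal.ofReal_one]

theorem sum_lintegral_samplePenalty_le {S : Finset C(I, ℝ)} {δ : ℝ} (hδ : 0 < δ)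
    {h : I × I → ℝ≥0∞} (hh : Measurable h) (hh2 : ∫⁻ p, h p ≤ 2) {W : SymmKernel}
    (hm : Measurable fun p : I × I => W p.1 p.2) (hb : ∀ x y, |W x y| ≤ 1) {n : ℕ} (hn : 0 < n) :
    ∑ ε, ∫⁻ x : Fin n → I, ENNReal.ofReal (signWeight (W.sample x) ε) * samplePenalty S δ h W ε x ≤
      ENNReal.ofReal (((∑ f ∈ S, ‖f‖ ^ 2) / δ ^ 2 + 32 / δ) / n) + 1 / 8 := by
  have hn' : (0 : ℝ) < n := by exact_mod_cast hn
  have hfm : ∀ f : C(I, ℝ), Measurable fun x : Fin n → I =>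
      ENNReal.ofReal (1 / δ ^ 2) * ENNReal.ofReal (((∑ i, f (x i)) / n - ∫ t, f t) ^ 2) := by
    intro f
    have : Continuous fun x : Fin n → I => ((∑ i, f (x i)) / n - ∫ t, f t) ^ 2 := by fun_prop
    exact this.measurable.ennreal_ofReal.const_mul _
  have hdm : ∀ ε : Sym2 (Fin n) → Bool, Measurable fun x : Fin n → I =>
      fourCycleSum fun e => boolSign (ε e) - W.sample x e := by
    intro ε
    unfold fourCycleSum
    have hs := fun e => (measurable_const (a := boolSign (ε e))).sub (W.measurable_sample hm e)
    exact Finset.measurable_sum _ fun j _ => Finset.measurable_sum _ fun k _ =>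
      (Finset.measurable_sum _ fun i _ => (hs _).mul (hs _)).pow_const 2
  have hw : ∀ ε : Sym2 (Fin n) → Bool, Measurable fun x : Fin n → I =>
      ENNReal.ofReal (signWeight (W.sample x) ε) := fun ε =>
    (measurable_signWeight_sample hm ε).ennreal_ofReal
  have hpm : ∀ ε : Sym2 (Fin n) → Bool, Measurable fun x : Fin n → I =>
      samplePenalty S δ h W ε x := by
    intro ε
    exact ((Finset.measurable_sum _ fun f _ => hfm f).add
      ((measurable_offDiagSum hh).const_mul _)).add ((hdm ε).ennreal_ofReal.const_mul _)
  rw [← lintegral_finsetSum (f := fun ε (x : Fin n → I) =>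
    ENNReal.ofReal (signWeight (W.sample x) ε) * samplePenalty S δ h W ε x) _
    fun ε _ => (hw ε).mul (hpm ε)]
  have hpt : ∀ x : Fin n → I,
      ∑ ε, ENNReal.ofReal (signWeight (W.sample x) ε) * samplePenalty S δ h W ε x ≤
      (∑ f ∈ S, ENNReal.ofReal (1 / δ ^ 2) *
        ENNReal.ofReal (((∑ i, f (x i)) / n - ∫ t, f t) ^ 2) +
        (16 * (n : ℝ≥0∞) ^ 2)⁻¹ * offDiagSum h x) + ENNReal.ofReal (32 / (δ * n)) := by
    intro x
    unfold samplePenalty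
    simp only [mul_add, Finset.sum_add_distrib]
    simp only [← Finset.sum_mul, sum_ofReal_signWeight_sample hb, one_mul]
    gcongr
    have e : ∀ ε : Sym2 (Fin n) → Bool, ENNReal.ofReal (signWeight (W.sample x) ε) *
        (ENNReal.ofReal (1 / (δ * n ^ 4)) *
          ENNReal.ofReal (fourCycleSum fun e => boolSign (ε e) - W.sample x e)) =
        ENNReal.ofReal (1 / (δ * n ^ 4) * (signWeight (W.sample x) ε *
          fourCycleSum fun e => boolSign (ε e) - W.sample x e)) := by
      intro ε
      rw [ENNReal.ofReal_mul (by positivity),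
        ENNReal.ofReal_mul (signWeight_nonneg (W.abs_sample_le hb x) ε)]
      ring
    simp only [e]
    rw [← ENNReal.ofReal_sum_of_nonneg]
    · refine ENNReal.ofReal_le_ofReal ?_
      rw [← Finset.mul_sum]
      calc _ ≤ 1 / (δ * n ^ 4) * (32 * (n : ℝ) ^ 3) := by
            gcongr
            exact sum_signWeight_mul_fourCycleSum_le (W.abs_sample_le hb x)
        _ = 32 / (δ * n) := by field_simp
    · intro ε _
      exact mul_nonneg (by positivity) (mul_nonneg (signWeight_nonneg (W.abs_sample_le hb x) ε)
        (fourCycleSum_nonneg _))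
  refine (lintegral_mono hpt).trans ?_
  rw [lintegral_add_right _ measurable_const,
    lintegral_add_left (Finset.measurable_sum _ fun f _ => hfm f),
    lintegral_finsetSum _ fun f _ => hfm f, lintegral_const, measure_univ, mul_one,
    lintegral_const_mul _ (measurable_offDiagSum hh)]
  have h1 : ∑ f ∈ S, ∫⁻ x : Fin n → I, ENNReal.ofReal (1 / δ ^ 2) *
      ENNReal.ofReal (((∑ i, f (x i)) / n - ∫ t, f t) ^ 2) ≤
      ENNReal.ofReal ((∑ f ∈ S, ‖f‖ ^ 2) / δ ^ 2 / n) := by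
    calc _ ≤ ∑ f ∈ S, ENNReal.ofReal (1 / δ ^ 2) * ENNReal.ofReal (‖f‖ ^ 2 / n) := by
          refine Finset.sum_le_sum fun f _ => ?_
          rw [lintegral_const_mul' _ _ ENNReal.ofReal_ne_top]
          gcongr
          exact lintegral_sq_average_sub_le hn f
      _ = ENNReal.ofReal ((∑ f ∈ S, ‖f‖ ^ 2) / δ ^ 2 / n) := by
          simp only [← ENNReal.ofReal_mul (show (0 : ℝ) ≤ 1 / δ ^ 2 by positivity)]
          rw [← ENNReal.ofReal_sum_of_nonneg fun f _ => by positivity]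
          congr 1
          rw [Finset.sum_div, Finset.sum_div]
          exact Finset.sum_congr rfl fun f _ => by field_simp
  have h2 : (16 * (n : ℝ≥0∞) ^ 2)⁻¹ * ∫⁻ x : Fin n → I, offDiagSum h x ≤ 1 / 8 := by
    have h0 : ((n : ℝ≥0∞) ^ 2) ≠ 0 := by simp [hn.ne']
    have ht : ((n : ℝ≥0∞) ^ 2) ≠ ∞ := ENNReal.pow_ne_top (ENNReal.natCast_ne_top n)
    calc _ ≤ (16 * (n : ℝ≥0∞) ^ 2)⁻¹ * ((n : ℝ≥0∞) ^ 2 * 2) := by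
          gcongr
          exact (lintegral_offDiagSum_le hh).trans (by gcongr)
      _ = 1 / 8 := by
          rw [ENNReal.mul_inv (Or.inl (by simp)) (Or.inl (by simp)), mul_assoc,
            ← mul_assoc _ _ (2 : ℝ≥0∞), ENNReal.inv_mul_cancel h0 ht, one_mul,
            show (16 : ℝ≥0∞) = 8 * 2 by norm_num,
            ENNReal.mul_inv (Or.inl (by simp)) (Or.inl (by simp)), mul_assoc,
            ENNReal.inv_mul_cancel (by simp) (by simp), mul_one, one_div]
  calc _ ≤ ENNReal.ofReal ((∑ f ∈ S, ‖f‖ ^ 2) / δ ^ 2 / n) + 1 / 8 +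
        ENNReal.ofReal (32 / (δ * n)) := by gcongr
    _ = ENNReal.ofReal (((∑ f ∈ S, ‖f‖ ^ 2) / δ ^ 2 + 32 / δ) / n) + 1 / 8 := by
        rw [add_right_comm, ← ENNReal.ofReal_add (by positivity) (by positivity)]
        congr 2
        field_simp

theorem exists_common_typicalSample {W W' : SymmKernel}
    (hm : Measurable fun p : I × I => W p.1 p.2) (hm' : Measurable fun p : I × I => W' p.1 p.2)
    (hb : ∀ x y, |W x y| ≤ 1) (hb' : ∀ x y, |W' x y| ≤ 1)
    (hd : ∀ (n : ℕ) (F : SimpleGraph (Fin n)), simpleDensity F W' = simpleDensity F W)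
    {h h' : I × I → ℝ≥0∞} (hh : Measurable h) (hh2 : ∫⁻ p, h p ≤ 2) (hh' : Measurable h')
    (hh2' : ∫⁻ p, h' p ≤ 2) (S : Finset C(I, ℝ)) {δ : ℝ} (hδ : 0 < δ) (N : ℕ) :
    ∃ n, N ≤ n ∧ 0 < n ∧ ∃ (x y : Fin n → I) (ε : Sym2 (Fin n) → Bool),
      IsTypicalSample S δ h W ε x ∧ IsTypicalSample S δ h' W' ε y := by
  obtain ⟨M, hM⟩ := exists_nat_ge (4 * ((∑ f ∈ S, ‖f‖ ^ 2) / δ ^ 2 + 32 / δ))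
  set n := max N (max M 1) with hn_def
  have hn : 0 < n := by omega
  have hn' : (0 : ℝ) < n := by exact_mod_cast hn
  have hMn : (M : ℝ) ≤ n := by exact_mod_cast (show M ≤ n by omega)
  have hbound : ENNReal.ofReal (((∑ f ∈ S, ‖f‖ ^ 2) / δ ^ 2 + 32 / δ) / n) + 1 / 8 ≤
      ENNReal.ofReal (3 / 8) := by
    have e : (1 / 8 : ℝ≥0∞) = ENNReal.ofReal (1 / 8) := by
      rw [ENNReal.ofReal_div_of_pos (by norm_num)]; simp
    rw [e, ← ENNReal.ofReal_add (by positivity) (by norm_num)]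
    refine ENNReal.ofReal_le_ofReal ?_
    have : ((∑ f ∈ S, ‖f‖ ^ 2) / δ ^ 2 + 32 / δ) / n ≤ 1 / 4 := by
      rw [div_le_iff₀ hn']; linarith
    linarith
  refine ⟨n, by omega, hn, ?_⟩
  have hint : ∀ {U : SymmKernel}, (Measurable fun p : I × I => U p.1 p.2) →
      (∀ x y, |U x y| ≤ 1) → ∀ ε : Sym2 (Fin n) → Bool,
      ∫⁻ x : Fin n → I, ENNReal.ofReal (signWeight (U.sample x) ε) =
        ENNReal.ofReal (∫ x : Fin n → I, signWeight (U.sample x) ε) := by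
    intro U hU hUb ε
    refine (ofReal_integral_eq_lintegral_ofReal ?_
      (ae_of_all _ fun x => signWeight_nonneg (U.abs_sample_le hUb x) ε)).symm
    refine Integrable.of_bound (C := 1) (measurable_signWeight_sample hU ε).aestronglyMeasurable
      (ae_of_all _ fun x => ?_)
    rw [Real.norm_of_nonneg (signWeight_nonneg (U.abs_sample_le hUb x) ε),
      ← sum_signWeight (U.sample x)]
    exact Finset.single_le_sum (fun ε _ => signWeight_nonneg (U.abs_sample_le hUb x) ε)
      (Finset.mem_univ ε)
  have htot : ∑ ε, ∫⁻ x : Fin n → I, ENNReal.ofReal (signWeight (W.sample x) ε) = 1 := by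
    rw [← lintegral_finsetSum _ fun ε _ => (measurable_signWeight_sample hm ε).ennreal_ofReal]
    simp only [sum_ofReal_signWeight_sample hb]
    simp
  obtain ⟨ε, x, y, hx, hy⟩ := exists_common_of_lintegral_lt
    (w := fun ε (x : Fin n → I) => ENNReal.ofReal (signWeight (W.sample x) ε))
    (w' := fun ε (x : Fin n → I) => ENNReal.ofReal (signWeight (W'.sample x) ε))
    (Φ := fun ε (x : Fin n → I) => samplePenalty S δ h W ε x)
    (Φ' := fun ε (x : Fin n → I) => samplePenalty S δ h' W' ε x)
    (μ := volume) (μ' := volume)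
    (fun ε => by rw [hint hm hb, hint hm' hb', integral_signWeight_sample_eq hm hm' hb hb' hd])
    (by
      rw [htot]
      refine lt_of_le_of_lt (add_le_add
        ((sum_lintegral_samplePenalty_le hδ hh hh2 hm hb hn).trans hbound)
        ((sum_lintegral_samplePenalty_le hδ hh' hh2' hm' hb' hn).trans hbound)) ?_
      rw [← ENNReal.ofReal_add (by norm_num) (by norm_num), ENNReal.ofReal_lt_one]
      norm_num)
  exact ⟨x, y, ε, isTypicalSample_of_samplePenalty_lt_one hδ hn hx,
    isTypicalSample_of_samplePenalty_lt_one hδ hn hy⟩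

/-! ### Continuous approximation with a common majorant -/

theorem exists_continuous_approx_majorant {V : I × I → ℝ} (hV : Measurable V) {C : ℝ}
    (hb : ∀ p, |V p| ≤ C) :
    ∃ (P : ℕ → (I × I →ᵇ ℝ)) (h : I × I → ℝ≥0∞), Measurable h ∧ ∫⁻ p, h p ≤ 2 ∧
      ∀ k p, ‖V p - P k p‖ₑ ≤ 2⁻¹ ^ k * h p := by
  have hint : Integrable V volume :=
    Integrable.of_bound hV.aestronglyMeasurable C (ae_of_all _ hb)
  have hex : ∀ k : ℕ, ∃ g : I × I →ᵇ ℝ,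
      ∫⁻ p, ‖V p - g p‖ₑ ≤ (2⁻¹ : ℝ≥0∞) ^ k * 2⁻¹ ^ k ∧ Integrable g volume := fun k =>
    hint.exists_boundedContinuous_lintegral_sub_le (by simp)
  choose P hP _ using hex
  have hm : ∀ k, Measurable fun p => (2 : ℝ≥0∞) ^ k * ‖V p - P k p‖ₑ := fun k =>
    ((hV.sub (P k).continuous.measurable).enorm).const_mul _
  have hcancel : ∀ k : ℕ, (2⁻¹ : ℝ≥0∞) ^ k * 2 ^ k = 1 := fun k => by
    rw [← mul_pow, ENNReal.inv_mul_cancel (by simp) (by simp), one_pow]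
  refine ⟨P, fun p => ∑' k, 2 ^ k * ‖V p - P k p‖ₑ, Measurable.tsum hm, ?_, ?_⟩
  · rw [lintegral_tsum fun k => (hm k).aemeasurable]
    calc _ ≤ ∑' k : ℕ, (2⁻¹ : ℝ≥0∞) ^ k := by
          refine ENNReal.tsum_le_tsum fun k => ?_
          rw [lintegral_const_mul' _ _ (by simp)]
          calc _ ≤ (2 : ℝ≥0∞) ^ k * (2⁻¹ ^ k * 2⁻¹ ^ k) := by gcongr; exact hP k
            _ = 2⁻¹ ^ k := by rw [← mul_assoc, mul_comm (2 ^ k), hcancel, one_mul]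
      _ = 2 := by rw [ENNReal.tsum_geometric, ENNReal.one_sub_inv_two, inv_inv]
  · intro k p
    calc ‖V p - P k p‖ₑ = 2⁻¹ ^ k * (2 ^ k * ‖V p - P k p‖ₑ) := by
          rw [← mul_assoc, hcancel, one_mul]
      _ ≤ _ := by
          gcongr
          exact ENNReal.le_tsum k

/-! ### Empirical measures -/

/-- The uniform probability measure on the points `z i`. -/
noncomputable def empirical {Z : Type*} [MeasurableSpace Z] {n : ℕ} (hn : 0 < n) (z : Fin n → Z) :
    ProbabilityMeasure Z :=
  ⟨(n : ℝ≥0∞)⁻¹ • ∑ i, Measure.dirac (z i), ⟨by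
    simp [ENNReal.inv_mul_cancel, hn.ne']⟩⟩

theorem integral_empirical {Z : Type*} [MeasurableSpace Z] {n : ℕ} (hn : 0 < n)
    (z : Fin n → Z) {f : Z → ℝ} (hf : StronglyMeasurable f) :
    ∫ t, f t ∂(empirical hn z : Measure Z) = (∑ i, f (z i)) / n := by
  change ∫ t, f t ∂((n : ℝ≥0∞)⁻¹ • ∑ i, Measure.dirac (z i)) = _
  rw [integral_smul_measure, integral_finsetSum_measure]
  · simp [integral_dirac' _ _ hf, div_eq_inv_mul]
  · intro i _
    exact integrable_dirac' hf (by simp)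

theorem integral_empirical_prod {Z : Type*} [TopologicalSpace Z] [MeasurableSpace Z]
    [OpensMeasurableSpace (Z × Z)] {n : ℕ} (hn : 0 < n) (z : Fin n → Z) (f : Z × Z →ᵇ ℝ) :
    ∫ t, f t ∂((empirical hn z : Measure Z).prod (empirical hn z)) =
      (∑ i, ∑ j, f (z i, z j)) / (n : ℝ) ^ 2 := by
  have hm : StronglyMeasurable f := f.continuous.measurable.stronglyMeasurable
  have hint : Integrable f ((empirical hn z : Measure Z).prod (empirical hn z)) :=
    Integrable.of_bound hm.aestronglyMeasurable ‖f‖ (ae_of_all _ f.norm_coe_le_norm)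
  rw [integral_prod _ hint, integral_empirical hn z hm.integral_prod_right']
  have : ∀ i, ∫ t, f (z i, t) ∂(empirical hn z : Measure Z) = (∑ j, f (z i, z j)) / n := fun i =>
    integral_empirical hn z (hm.comp_measurable measurable_prodMk_left)
  simp only [this]
  rw [← Finset.sum_div, div_div, sq]

/-! ### Determining a bounded density by products of test functions -/

theorem ae_eq_of_integral_mul_mul_eq {Z T : Type*} [TopologicalSpace Z] [MeasurableSpace Z]
    [BorelSpace Z] [HasOuterApproxClosed Z] [TopologicalSpace T] [MeasurableSpace T]
    [BorelSpace T] [HasOuterApproxClosed T] {μ : Measure (Z × T)} [IsFiniteMeasure μ]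
    {D D' : Z × T → ℝ} (hD : Measurable D) (hD' : Measurable D') (hb : ∀ p, |D p| ≤ 1)
    (hb' : ∀ p, |D' p| ≤ 1)
    (h : ∀ (f : Z →ᵇ ℝ) (g : T →ᵇ ℝ),
      ∫ p, f p.1 * g p.2 * D p ∂μ = ∫ p, f p.1 * g p.2 * D' p ∂μ) :
    D =ᵐ[μ] D' := by
  have hden : ∀ {K : Z × T → ℝ}, Measurable K → (∀ p, |K p| ≤ 1) →
      IsFiniteMeasure (μ.withDensity fun p => ENNReal.ofReal (K p + 1)) ∧
      ∀ (f : Z →ᵇ ℝ) (g : T →ᵇ ℝ),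
        ∫ p, f p.1 * g p.2 ∂(μ.withDensity fun p => ENNReal.ofReal (K p + 1)) =
          ∫ p, f p.1 * g p.2 * K p ∂μ + ∫ p, f p.1 * g p.2 ∂μ := by
    intro K hK hKb
    have hint : Integrable (fun p => K p + 1) μ :=
      Integrable.of_bound (hK.add_const 1).aestronglyMeasurable 2 (ae_of_all _ fun p => by
        have := abs_le.1 (hKb p)
        rw [Real.norm_eq_abs, abs_le]; constructor <;> linarith)
    refine ⟨isFiniteMeasure_withDensity_ofReal hint.2, fun f g => ?_⟩
    have hfgm : Measurable fun p : Z × T => f p.1 * g p.2 :=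
      (f.continuous.measurable.comp measurable_fst).mul
        (g.continuous.measurable.comp measurable_snd)
    have hfgb : ∀ p : Z × T, ‖f p.1 * g p.2‖ ≤ ‖f‖ * ‖g‖ := fun p => by
      rw [norm_mul]
      exact mul_le_mul (f.norm_coe_le_norm _) (g.norm_coe_le_norm _) (norm_nonneg _) (norm_nonneg _)
    have hfg : Integrable (fun p : Z × T => f p.1 * g p.2) μ :=
      Integrable.of_bound hfgm.aestronglyMeasurable _ (ae_of_all _ hfgb)
    have hfgK : Integrable (fun p : Z × T => f p.1 * g p.2 * K p) μ := by
      refine Integrable.of_bound (hfgm.mul hK).aestronglyMeasurable (‖f‖ * ‖g‖ * 1)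
        (ae_of_all _ fun p => ?_)
      rw [norm_mul]
      exact mul_le_mul (hfgb p) (hKb p) (norm_nonneg _) (by positivity)
    rw [integral_withDensity_eq_integral_toReal_smul (hK.add_const 1).ennreal_ofReal
      (ae_of_all _ fun _ => ENNReal.ofReal_lt_top), ← integral_add hfgK hfg]
    refine integral_congr_ae (ae_of_all _ fun p => ?_)
    have := abs_le.1 (hKb p)
    simp only [smul_eq_mul]
    rw [ENNReal.toReal_ofReal (by linarith)]
    ring
  obtain ⟨_, h1⟩ := hden hD hb
  obtain ⟨_, h2⟩ := hden hD' hb'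
  have heq : μ.withDensity (fun p => ENNReal.ofReal (D p + 1)) =
      μ.withDensity fun p => ENNReal.ofReal (D' p + 1) :=
    Measure.ext_of_integral_mul_boundedContinuousFunction fun f g => by rw [h1, h2, h]
  have := (withDensity_eq_iff_of_sigmaFinite (hD.add_const 1).ennreal_ofReal.aemeasurable
    (hD'.add_const 1).ennreal_ofReal.aemeasurable).1 heq
  filter_upwards [this] with p hp
  have h3 := abs_le.1 (hb p)
  have h4 := abs_le.1 (hb' p)
  have := (ENNReal.ofReal_eq_ofReal_iff (by linarith) (by linarith)).1 hp
  linarith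

/-! ### Passing to the limit along empirical measures -/

theorem sum_offDiag_abs_sub_le {W : SymmKernel} {P : I × I → ℝ} {h : I × I → ℝ≥0∞} {k : ℕ}
    (hP : ∀ p, ‖W p.1 p.2 - P p‖ₑ ≤ 2⁻¹ ^ k * h p) {n : ℕ} {x : Fin n → I}
    (hx : offDiagSum h x ≤ 16 * n ^ 2) :
    ∑ a, ∑ b, (if a = b then 0 else |W (x a) (x b) - P (x a, x b)|) ≤
      16 * (1 / 2) ^ k * (n : ℝ) ^ 2 := by
  have h1 : ENNReal.ofReal
      (∑ a, ∑ b, (if a = b then 0 else |W (x a) (x b) - P (x a, x b)|)) ≤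
      ENNReal.ofReal (16 * (1 / 2) ^ k * (n : ℝ) ^ 2) := by
    rw [ENNReal.ofReal_sum_of_nonneg fun a _ => Finset.sum_nonneg fun b _ => by
      split_ifs <;> positivity]
    calc _ ≤ ∑ a, ∑ b, 2⁻¹ ^ k * (if a = b then 0 else h (x a, x b)) := by
          refine Finset.sum_le_sum fun a _ => ?_
          rw [ENNReal.ofReal_sum_of_nonneg fun b _ => by split_ifs <;> positivity]
          refine Finset.sum_le_sum fun b _ => ?_
          split_ifs
          · simp
          · rw [← Real.norm_eq_abs, ofReal_norm]
            exact hP (x a, x b)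
      _ = 2⁻¹ ^ k * offDiagSum h x := by simp only [offDiagSum, Finset.mul_sum]
      _ ≤ 2⁻¹ ^ k * (16 * n ^ 2) := by gcongr
      _ = _ := by
          rw [ENNReal.ofReal_mul (by positivity), ENNReal.ofReal_mul (by positivity),
            ENNReal.ofReal_pow (by positivity), ENNReal.ofReal_pow (by positivity), one_div,
            ENNReal.ofReal_inv_of_pos (by norm_num)]
          simp only [ENNReal.ofReal_natCast, ENNReal.ofReal_ofNat]
          ring
  exact (ENNReal.ofReal_le_ofReal_iff (by positivity)).1 h1

theorem abs_average_sub_average_sample_le {W : SymmKernel} {P : I × I →ᵇ ℝ} {h : I × I → ℝ≥0∞}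
    {k : ℕ} (hP : ∀ p, ‖W p.1 p.2 - P p‖ₑ ≤ 2⁻¹ ^ k * h p) {n : ℕ} (hn : 0 < n) {x : Fin n → I}
    (hx : offDiagSum h x ≤ 16 * n ^ 2) {f g : Fin n → ℝ} {A B : ℝ} (hf : ∀ a, |f a| ≤ A)
    (hg : ∀ a, |g a| ≤ B) :
    |(∑ a, ∑ b, f a * g b * P (x a, x b)) / (n : ℝ) ^ 2 -
      (∑ a, ∑ b, f a * g b * W.sample x s(a, b)) / (n : ℝ) ^ 2| ≤
      A * B * (16 * (1 / 2) ^ k + ‖P‖ / n) := by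
  have hn' : (0 : ℝ) < n := by exact_mod_cast hn
  have hA : 0 ≤ A := (abs_nonneg _).trans (hf ⟨0, hn⟩)
  have hB : 0 ≤ B := (abs_nonneg _).trans (hg ⟨0, hn⟩)
  rw [← sub_div, abs_div, abs_of_pos (show (0 : ℝ) < (n : ℝ) ^ 2 by positivity),
    div_le_iff₀ (by positivity)]
  have hterm : ∀ a b, |f a * g b * P (x a, x b) - f a * g b * W.sample x s(a, b)| ≤
      A * B * ((if a = b then 0 else |W (x a) (x b) - P (x a, x b)|) +
        (if a = b then ‖P‖ else 0)) := by
    intro a b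
    rw [← mul_sub, abs_mul, abs_mul]
    refine mul_le_mul (mul_le_mul (hf a) (hg b) (abs_nonneg _) hA) ?_ (abs_nonneg _)
      (by positivity)
    by_cases hab : a = b
    · subst hab
      have : W.sample x s(a, a) = 0 := if_pos rfl
      simpa [this] using P.norm_coe_le_norm (x a, x a)
    · rw [W.sample_mk_of_ne x hab]
      simp [hab, abs_sub_comm]
  calc _ ≤ ∑ a, ∑ b, |f a * g b * P (x a, x b) - f a * g b * W.sample x s(a, b)| := by
        rw [← Finset.sum_sub_distrib]
        refine (Finset.abs_sum_le_sum_abs _ _).trans (Finset.sum_le_sum fun a _ => ?_)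
        rw [← Finset.sum_sub_distrib]
        exact Finset.abs_sum_le_sum_abs _ _
    _ ≤ ∑ a, ∑ b, A * B * ((if a = b then 0 else |W (x a) (x b) - P (x a, x b)|) +
        (if a = b then ‖P‖ else 0)) :=
        Finset.sum_le_sum fun a _ => Finset.sum_le_sum fun b _ => hterm a b
    _ = A * B * (∑ a, ∑ b, (if a = b then 0 else |W (x a) (x b) - P (x a, x b)|) + n * ‖P‖) := by
        simp only [← Finset.mul_sum, Finset.sum_add_distrib]
        simp
    _ ≤ A * B * (16 * (1 / 2) ^ k * (n : ℝ) ^ 2 + n * ‖P‖) := by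
        gcongr
        exact sum_offDiag_abs_sub_le hP hx
    _ = A * B * (16 * (1 / 2) ^ k + ‖P‖ / n) * (n : ℝ) ^ 2 := by
        field_simp

theorem abs_integral_mul_sub_le {Z : Type*} [MeasurableSpace Z] {γ : Measure Z}
    [IsProbabilityMeasure γ] {π : Z → I} (hπ : MeasurePreserving π γ volume)
    {W : SymmKernel} (hm : Measurable fun p : I × I => W p.1 p.2) (hb : ∀ x y, |W x y| ≤ 1)
    {P : I × I →ᵇ ℝ} {h : I × I → ℝ≥0∞} {k : ℕ} (hh : ∫⁻ p, h p ≤ 2)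
    (hP : ∀ p, ‖W p.1 p.2 - P p‖ₑ ≤ 2⁻¹ ^ k * h p) {F : Z × Z → ℝ} (hF : Measurable F)
    {A : ℝ} (hA : 0 ≤ A) (hFA : ∀ p, |F p| ≤ A) :
    |∫ p, F p * P (π p.1, π p.2) ∂(γ.prod γ) - ∫ p, F p * W (π p.1) (π p.2) ∂(γ.prod γ)| ≤
      A * (2 * (1 / 2) ^ k) := by
  have hππ : MeasurePreserving (Prod.map π π) (γ.prod γ) (volume.prod volume) := hπ.prod hπ
  have hWm : Measurable fun p : Z × Z => W (π p.1) (π p.2) := hm.comp hππ.measurable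
  have hPm : Measurable fun p : Z × Z => P (π p.1, π p.2) :=
    P.continuous.measurable.comp hππ.measurable
  have hi1 : Integrable (fun p : Z × Z => F p * P (π p.1, π p.2)) (γ.prod γ) := by
    refine Integrable.of_bound (hF.mul hPm).aestronglyMeasurable (A * ‖P‖)
      (ae_of_all _ fun p => ?_)
    rw [norm_mul]
    exact mul_le_mul (hFA p) (P.norm_coe_le_norm _) (norm_nonneg _) hA
  have hi2 : Integrable (fun p : Z × Z => F p * W (π p.1) (π p.2)) (γ.prod γ) := by
    refine Integrable.of_bound (hF.mul hWm).aestronglyMeasurable (A * 1)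
      (ae_of_all _ fun p => ?_)
    rw [norm_mul]
    exact mul_le_mul (hFA p) (hb _ _) (norm_nonneg _) hA
  rw [← integral_sub hi1 hi2, ← Real.norm_eq_abs]
  have hlint : ∫⁻ p, ‖F p * P (π p.1, π p.2) - F p * W (π p.1) (π p.2)‖ₑ ∂(γ.prod γ) ≤
      ENNReal.ofReal (A * (2 * (1 / 2) ^ k)) := by
    calc _ ≤ ∫⁻ p, ENNReal.ofReal A * ‖W (π p.1) (π p.2) - P (π p.1, π p.2)‖ₑ ∂(γ.prod γ) := by
          refine lintegral_mono fun p => ?_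
          rw [← mul_sub, enorm_mul, ← neg_sub (W _ _), enorm_neg]
          gcongr
          rw [← ofReal_norm]
          exact ENNReal.ofReal_le_ofReal (hFA p)
      _ = ENNReal.ofReal A *
            ∫⁻ p, ‖W (π p.1) (π p.2) - P (π p.1, π p.2)‖ₑ ∂(γ.prod γ) :=
          lintegral_const_mul' _ _ ENNReal.ofReal_ne_top
      _ = ENNReal.ofReal A * ∫⁻ p : I × I, ‖W p.1 p.2 - P p‖ₑ := by
          congr 1
          exact hππ.lintegral_comp (f := fun p : I × I => ‖W p.1 p.2 - P p‖ₑ)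
            (hm.sub P.continuous.measurable).enorm
      _ ≤ ENNReal.ofReal A * (2⁻¹ ^ k * 2) := by
          gcongr
          refine (lintegral_mono hP).trans ?_
          rw [lintegral_const_mul' _ _ (by simp)]
          gcongr
      _ = _ := by
          rw [ENNReal.ofReal_mul hA, ENNReal.ofReal_mul (by norm_num),
            ENNReal.ofReal_pow (by norm_num), one_div, ENNReal.ofReal_inv_of_pos (by norm_num)]
          simp only [ENNReal.ofReal_ofNat]
          ring
  have h1 := (enorm_integral_le_lintegral_enorm _).trans hlint
  rw [← ofReal_norm, ENNReal.ofReal_le_ofReal_iff (by positivity)] at h1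
  exact h1

theorem tendsto_average_sample {ι : Type*} {l : Filter ι} {n : ι → ℕ} (hn : ∀ i, 0 < n i)
    (hn_top : Tendsto n l atTop) {Z : Type*} [TopologicalSpace Z] [MeasurableSpace Z]
    [BorelSpace Z] [SecondCountableTopology Z] [TopologicalSpace.PseudoMetrizableSpace Z]
    (z : ∀ i, Fin (n i) → Z) {γ : ProbabilityMeasure Z}
    (hγ : Tendsto (fun i => empirical (hn i) (z i)) l (𝓝 γ)) {π : Z → I} (hπc : Continuous π)
    (hπ : MeasurePreserving π (γ : Measure Z) volume)
    {W : SymmKernel} (hm : Measurable fun p : I × I => W p.1 p.2) (hb : ∀ x y, |W x y| ≤ 1)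
    {P : ℕ → (I × I →ᵇ ℝ)} {h : I × I → ℝ≥0∞} (hh : ∫⁻ p, h p ≤ 2)
    (hP : ∀ k p, ‖W p.1 p.2 - P k p‖ₑ ≤ 2⁻¹ ^ k * h p)
    (hz : ∀ i, offDiagSum h (fun a => π (z i a)) ≤ 16 * n i ^ 2) (f g : Z →ᵇ ℝ) :
    Tendsto (fun i => (∑ a, ∑ b, f (z i a) * g (z i b) *
        W.sample (fun a => π (z i a)) s(a, b)) / (n i : ℝ) ^ 2) l
      (𝓝 (∫ p, f p.1 * g p.2 * W (π p.1) (π p.2) ∂((γ : Measure Z).prod (γ : Measure Z)))) := by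
  have hprod : Tendsto (fun i => (empirical (hn i) (z i)).prod (empirical (hn i) (z i))) l
      (𝓝 (γ.prod γ)) :=
    ((ProbabilityMeasure.continuous_prod (α := Z) (β := Z)).tendsto (γ, γ)).comp
      (hγ.prodMk_nhds hγ)
  rw [ProbabilityMeasure.tendsto_iff_forall_integral_tendsto] at hprod
  have hFA : ∀ p : Z × Z, |f p.1 * g p.2| ≤ ‖f‖ * ‖g‖ := fun p => by
    rw [abs_mul]
    exact mul_le_mul (f.norm_coe_le_norm _) (g.norm_coe_le_norm _) (abs_nonneg _) (norm_nonneg _)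
  have hFm : Measurable fun p : Z × Z => f p.1 * g p.2 :=
    (f.continuous.measurable.comp measurable_fst).mul (g.continuous.measurable.comp measurable_snd)
  have hlim : ∀ k, Tendsto (fun i => (∑ a, ∑ b, f (z i a) * g (z i b) *
      P k (π (z i a), π (z i b))) / (n i : ℝ) ^ 2) l
      (𝓝 (∫ p, f p.1 * g p.2 * P k (π p.1, π p.2) ∂((γ : Measure Z).prod (γ : Measure Z)))) := by
    intro k
    let G : Z × Z →ᵇ ℝ := BoundedContinuousFunction.ofNormedAddCommGroup
      (fun p => f p.1 * g p.2 * P k (π p.1, π p.2)) (by fun_prop) (‖f‖ * ‖g‖ * ‖P k‖) (by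
        intro p
        rw [norm_mul]
        exact mul_le_mul (hFA p) ((P k).norm_coe_le_norm _) (norm_nonneg _) (by positivity))
    have := hprod G
    refine this.congr fun i => ?_
    exact integral_empirical_prod (hn i) (z i) G
  rw [Metric.tendsto_nhds]
  intro e he
  have hA : 0 ≤ ‖f‖ * ‖g‖ := by positivity
  obtain ⟨k, hk⟩ : ∃ k : ℕ, ‖f‖ * ‖g‖ * 18 * (1 / 2 : ℝ) ^ k < e / 4 := by
    have : Tendsto (fun k : ℕ => ‖f‖ * ‖g‖ * 18 * (1 / 2 : ℝ) ^ k) atTop (𝓝 0) := by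
      simpa using (tendsto_pow_atTop_nhds_zero_of_lt_one (by norm_num : (0 : ℝ) ≤ 1 / 2)
        (by norm_num)).const_mul (‖f‖ * ‖g‖ * 18)
    exact (this.eventually_lt_const (by linarith)).exists
  have hdiag : Tendsto (fun i => ‖f‖ * ‖g‖ * (‖P k‖ / (n i : ℝ))) l (𝓝 0) := by
    have : Tendsto (fun i => ‖P k‖ / (n i : ℝ)) l (𝓝 0) :=
      Tendsto.div_atTop tendsto_const_nhds (tendsto_natCast_atTop_atTop.comp hn_top)
    simpa using this.const_mul (‖f‖ * ‖g‖)
  filter_upwards [(Metric.tendsto_nhds.1 (hlim k)) (e / 4) (by linarith),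
    hdiag.eventually_lt_const (show (0 : ℝ) < e / 4 by linarith)] with i h1 h2
  have h3 := abs_average_sub_average_sample_le (hP k) (hn i) (hz i)
    (f := fun a => f (z i a)) (g := fun a => g (z i a)) (A := ‖f‖) (B := ‖g‖)
    (fun a => f.norm_coe_le_norm _) (fun a => g.norm_coe_le_norm _)
  have h4 := abs_integral_mul_sub_le hπ hm hb hh (hP k) hFm hA hFA
  rw [Real.dist_eq] at h1 ⊢
  rw [abs_le] at h3 h4
  rw [abs_lt] at h1 ⊢
  rw [mul_add] at h3
  have h5 : ‖f‖ * ‖g‖ * (16 * (1 / 2) ^ k) + ‖f‖ * ‖g‖ * (2 * (1 / 2) ^ k) =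
    ‖f‖ * ‖g‖ * 18 * (1 / 2 : ℝ) ^ k := by ring
  constructor <;> linarith

theorem exists_coupling_of_simpleDensity_eq_of_le_one {W W' : SymmKernel}
    (hm : Measurable fun p : I × I => W p.1 p.2) (hm' : Measurable fun p : I × I => W' p.1 p.2)
    (hb : ∀ x y, |W x y| ≤ 1) (hb' : ∀ x y, |W' x y| ≤ 1)
    (hd : ∀ (n : ℕ) (F : SimpleGraph (Fin n)), simpleDensity F W' = simpleDensity F W) :
    ∃ γ : Measure (I × I), IsProbabilityMeasure γ ∧
      γ.map Prod.fst = (volume : Measure I) ∧ γ.map Prod.snd = (volume : Measure I) ∧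
      ∀ᵐ p ∂(γ.prod γ), W p.1.1 p.2.1 = W' p.1.2 p.2.2 := by
  classical
  obtain ⟨P, h, hh, hh2, hP⟩ := exists_continuous_approx_majorant hm (fun p => hb p.1 p.2)
  obtain ⟨P', h', hh', hh2', hP'⟩ := exists_continuous_approx_majorant hm' (fun p => hb' p.1 p.2)
  have hex := fun i : Finset C(I, ℝ) × ℕ => exists_common_typicalSample hm hm' hb hb' hd hh hh2
    hh' hh2' i.1 (δ := 1 / ((i.2 : ℝ) + 1)) (by positivity) i.2
  choose n hnN hn0 x y ε hx hy using hex
  let 𝒰 : Ultrafilter (Finset C(I, ℝ) × ℕ) := Ultrafilter.of atTop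
  have h𝒰 : (𝒰 : Filter (Finset C(I, ℝ) × ℕ)) ≤ atTop := Ultrafilter.of_le _
  have hsnd : Tendsto (fun i : Finset C(I, ℝ) × ℕ => i.2) 𝒰 atTop := by
    refine Tendsto.mono_left ?_ h𝒰
    rw [← prod_atTop_atTop_eq]
    exact tendsto_snd
  have hntop : Tendsto n 𝒰 atTop := tendsto_atTop_mono hnN hsnd
  have hδ : Tendsto (fun i : Finset C(I, ℝ) × ℕ => 1 / ((i.2 : ℝ) + 1)) 𝒰 (𝓝 0) :=
    tendsto_one_div_add_atTop_nhds_zero_nat.comp hsnd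
  let z : ∀ i, Fin (n i) → I × I := fun i a => (x i a, y i a)
  obtain ⟨γ, -, hγ⟩ := isCompact_univ.ultrafilter_le_nhds
    (𝒰.map fun i => empirical (hn0 i) (z i)) (by simp)
  have hγ : Tendsto (fun i => empirical (hn0 i) (z i)) 𝒰 (𝓝 γ) := hγ
  have hmarg : ∀ π : I × I → I, Continuous π → (∀ i, ∀ f ∈ i.1,
      |(∑ a, f (π (z i a))) / (n i : ℝ) - ∫ t, f t| ≤ 1 / ((i.2 : ℝ) + 1)) →
      MeasurePreserving π (γ : Measure (I × I)) volume := by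
    intro π hπ hclose
    refine ⟨hπ.measurable, ?_⟩
    have : IsFiniteMeasure ((γ : Measure (I × I)).map π) := inferInstance
    refine ext_of_forall_integral_eq_of_IsFiniteMeasure fun f => ?_
    rw [integral_map hπ.aemeasurable f.continuous.aestronglyMeasurable]
    have h1 : Tendsto (fun i => (∑ a, f (π (z i a))) / (n i : ℝ)) 𝒰
        (𝓝 (∫ p, f (π p) ∂(γ : Measure (I × I)))) := by
      have := ProbabilityMeasure.tendsto_iff_forall_integral_tendsto.1 hγ
        (f.compContinuous ⟨π, hπ⟩)
      refine this.congr fun i => ?_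
      exact integral_empirical (hn0 i) (z i)
        ((f.continuous.comp hπ).measurable.stronglyMeasurable)
    have h2 : Tendsto (fun i => (∑ a, f (π (z i a))) / (n i : ℝ)) 𝒰 (𝓝 (∫ t, f t)) := by
      rw [tendsto_iff_norm_sub_tendsto_zero]
      refine squeeze_zero' (Eventually.of_forall fun _ => norm_nonneg _) ?_ hδ
      have : ∀ᶠ i : Finset C(I, ℝ) × ℕ in 𝒰, f.toContinuousMap ∈ i.1 := by
        refine h𝒰 ?_
        filter_upwards [eventually_ge_atTop (({f.toContinuousMap} : Finset C(I, ℝ)), 0)] with i hi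
        exact hi.1 (Finset.mem_singleton_self _)
      filter_upwards [this] with i hi
      exact hclose i _ hi
    exact tendsto_nhds_unique h1 h2
  have hfst := hmarg Prod.fst continuous_fst fun i f hf => (hx i).average f hf
  have hsnd' := hmarg Prod.snd continuous_snd fun i f hf => (hy i).average f hf
  refine ⟨γ, inferInstance, hfst.map_eq, hsnd'.map_eq, ?_⟩
  refine ae_eq_of_integral_mul_mul_eq (Z := I × I) (T := I × I)
    (D := fun p => W p.1.1 p.2.1) (D' := fun p => W' p.1.2 p.2.2)
    (hm.comp ((measurable_fst.comp measurable_fst).prodMk (measurable_fst.comp measurable_snd)))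
    (hm'.comp ((measurable_snd.comp measurable_fst).prodMk (measurable_snd.comp measurable_snd)))
    (fun p => hb _ _) (fun p => hb' _ _) fun f g => ?_
  have t1 := tendsto_average_sample hn0 hntop z hγ continuous_fst hfst hm hb hh2 hP
    (fun i => (hx i).offDiag) f g
  have t2 := tendsto_average_sample hn0 hntop z hγ continuous_snd hsnd' hm' hb' hh2' hP'
    (fun i => (hy i).offDiag) f g
  have hcut : ∀ (U : SymmKernel) (u : ∀ i, Fin (n i) → I),
      (∀ i, fourCycleSum (fun e => boolSign (ε i e) - U.sample (u i) e) ≤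
        1 / ((i.2 : ℝ) + 1) * (n i : ℝ) ^ 4) →
      Tendsto (fun i => (∑ a, ∑ b, f (z i a) * g (z i b) *
        (boolSign (ε i s(a, b)) - U.sample (u i) s(a, b))) / (n i : ℝ) ^ 2) 𝒰 (𝓝 0) := by
    intro U u hU
    have h4 : Tendsto (fun i => ((∑ a, ∑ b, f (z i a) * g (z i b) *
        (boolSign (ε i s(a, b)) - U.sample (u i) s(a, b))) / (n i : ℝ) ^ 2) ^ 4) 𝒰 (𝓝 0) := by
      refine squeeze_zero (g := fun i => (‖f‖ * ‖g‖) ^ 4 * (1 / ((i.2 : ℝ) + 1)))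
        (fun i => by positivity) (fun i => ?_) (by simpa using hδ.const_mul ((‖f‖ * ‖g‖) ^ 4))
      have hni : (0 : ℝ) < n i := by exact_mod_cast hn0 i
      rw [div_pow, div_le_iff₀ (by positivity)]
      refine (bilinear_pow_four_le (fun e => boolSign (ε i e) - U.sample (u i) e)
        (f := fun a => f (z i a)) (g := fun a => g (z i a)) (A := ‖f‖) (B := ‖g‖)
        (fun a => f.norm_coe_le_norm _) (fun a => g.norm_coe_le_norm _)).trans ?_
      calc _ ≤ (‖f‖ * ‖g‖) ^ 4 * (n i : ℝ) ^ 4 * (1 / ((i.2 : ℝ) + 1) * (n i : ℝ) ^ 4) := by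
            gcongr
            exact hU i
        _ = _ := by ring
    have h2 := (Real.continuous_sqrt.comp Real.continuous_sqrt).continuousAt.tendsto.comp h4
    rw [tendsto_zero_iff_abs_tendsto_zero]
    simp only [Function.comp_def, Real.sqrt_zero] at h2
    refine h2.congr fun i => ?_
    rw [show ∀ t : ℝ, t ^ 4 = (t ^ 2) ^ 2 from fun t => by ring, Real.sqrt_sq (sq_nonneg _),
      Real.sqrt_sq_eq_abs]
    rfl
  have c1 := hcut W x fun i => (hx i).cut
  have c2 := hcut W' y fun i => (hy i).cut
  refine tendsto_nhds_unique t1 ?_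
  have := (c2.sub c1).add t2
  simp only [sub_zero, zero_add] at this
  refine this.congr fun i => ?_
  rw [← sub_div, ← add_div, ← Finset.sum_sub_distrib, ← Finset.sum_add_distrib]
  congr 1
  refine Finset.sum_congr rfl fun a _ => ?_
  rw [← Finset.sum_sub_distrib, ← Finset.sum_add_distrib]
  refine Finset.sum_congr rfl fun b _ => ?_
  change _ = f (z i a) * g (z i b) * W.sample (x i) s(a, b)
  change f (z i a) * g (z i b) * (boolSign (ε i s(a, b)) - W'.sample (y i) s(a, b)) -
    f (z i a) * g (z i b) * (boolSign (ε i s(a, b)) - W.sample (x i) s(a, b)) +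
    f (z i a) * g (z i b) * W'.sample (y i) s(a, b) = _
  ring

/-! ### The rank of a point for a measurable linear order -/

section Rank

variable {Ω : Type*} [MeasurableSpace Ω] {μ : Measure Ω} [IsProbabilityMeasure μ]
  {r : Ω → Ω → Prop}

theorem measure_null_initial_eq_zero (hr : MeasurableSet {p : Ω × Ω | r p.1 p.2})
    (htot : ∀ a b, r a b ∨ r b a) {E : Set Ω} (hE : ∀ x ∈ E, μ ({t | r t x} ∩ E) = 0)
    (hEm : MeasurableSet E) : μ E = 0 := by
  set A : Set (Ω × Ω) := {p | p.1 ∈ E ∧ p.2 ∈ E ∧ r p.2 p.1} with hA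
  have hAm : MeasurableSet A :=
    (measurable_fst hEm).inter ((measurable_snd hEm).inter (measurable_swap hr))
  have hA0 : (μ.prod μ) A = 0 := by
    rw [Measure.measure_prod_null hAm]
    refine ae_of_all _ fun x => ?_
    by_cases hx : x ∈ E
    · exact measure_mono_null (t := {t | r t x} ∩ E) (fun t ht => ⟨ht.2.2, ht.2.1⟩) (hE x hx)
    · have : Prod.mk x ⁻¹' A = ∅ := Set.eq_empty_of_forall_notMem fun t ht => hx ht.1
      simp [this]
  have hA1 : (μ.prod μ) (Prod.swap ⁻¹' A) = 0 := by
    rw [Measure.measurePreserving_swap.measure_preimage hAm.nullMeasurableSet, hA0]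
  have hsub : E ×ˢ E ⊆ A ∪ Prod.swap ⁻¹' A := by
    rintro ⟨a, b⟩ ⟨ha, hb⟩
    rcases htot a b with h | h
    · exact Or.inr ⟨hb, ha, h⟩
    · exact Or.inl ⟨ha, hb, h⟩
  have := measure_mono_null hsub (measure_union_null hA0 hA1)
  rw [Measure.prod_prod] at this
  exact (mul_self_eq_zero).1 this

theorem measure_rank_le_le (hr : MeasurableSet {p : Ω × Ω | r p.1 p.2})
    (htot : ∀ a b, r a b ∨ r b a) (htrans : ∀ a b c, r a b → r b c → r a c) (c : ℝ≥0∞) :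
    μ {x | μ {t | r t x} ≤ c} ≤ c := by
  have hDm : ∀ x, MeasurableSet {t | r t x} := fun x => measurable_prodMk_right hr
  have hrank : Measurable fun x => μ {t | r t x} := measurable_measure_prodMk_right hr
  set S := {x | μ {t | r t x} ≤ c} with hS
  have hSm : MeasurableSet S := measurableSet_le hrank measurable_const
  rcases S.eq_empty_or_nonempty with h0 | hne
  · simp [h0]
  obtain ⟨u, -, hu, hmem⟩ := exists_seq_tendsto_sSup
    (hne.image fun x => μ {t | r t x}) (OrderTop.bddAbove _)
  choose x hxS hxu using hmem
  set U := ⋃ n, {t | r t (x n)} with hU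
  have hUm : MeasurableSet U := MeasurableSet.iUnion fun n => hDm _
  have hUc : μ U ≤ c := by
    have hdir : Directed (· ⊆ ·) fun n => {t | r t (x n)} := by
      intro a b
      rcases htot (x a) (x b) with h | h
      · exact ⟨b, fun t ht => htrans _ _ _ ht h, subset_rfl⟩
      · exact ⟨a, subset_rfl, fun t ht => htrans _ _ _ ht h⟩
    rw [hU, hdir.measure_iUnion]
    exact iSup_le fun n => hxS n
  have hE0 : μ (S \ U) = 0 := by
    refine measure_null_initial_eq_zero hr htot (fun y hy => ?_) (hSm.diff hUm)
    have hUy : U ⊆ {t | r t y} := by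
      refine Set.iUnion_subset fun n t ht => ?_
      have hn : ¬ r y (x n) := fun h => hy.2 (Set.mem_iUnion.2 ⟨n, h⟩)
      exact htrans _ _ _ ht ((htot y (x n)).resolve_left hn)
    refine measure_mono_null (t := {t | r t y} \ U) (fun t ht => ⟨ht.1, ht.2.2⟩) ?_
    rw [measure_sdiff hUy hUm.nullMeasurableSet (measure_ne_top _ _), tsub_eq_zero_iff_le]
    have h1 : μ {t | r t y} ≤ sSup ((fun x => μ {t | r t x}) '' S) :=
      le_sSup ⟨y, hy.1, rfl⟩
    refine h1.trans (le_of_tendsto' hu fun n => ?_)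
    rw [← hxu n]
    exact measure_mono (Set.subset_iUnion (fun n => {t | r t (x n)}) n)
  calc μ S ≤ μ (S \ U ∪ U) := measure_mono fun y hy => by
        by_cases h : y ∈ U
        · exact Or.inr h
        · exact Or.inl ⟨hy, h⟩
    _ ≤ μ (S \ U) + μ U := measure_union_le _ _
    _ ≤ c := by rw [hE0, zero_add]; exact hUc

theorem measurePreserving_rank (hr : MeasurableSet {p : Ω × Ω | r p.1 p.2})
    (htot : ∀ a b, r a b ∨ r b a) (htrans : ∀ a b c, r a b → r b c → r a c)
    (hnull : ∀ a, μ {t | r t a ∧ r a t} = 0) :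
    MeasurePreserving (fun x => (⟨μ.real {t | r t x}, measureReal_nonneg, measureReal_le_one⟩ : I))
      μ volume := by
  have hDm : ∀ x, MeasurableSet {t | r t x} := fun x => measurable_prodMk_right hr
  have hDm' : ∀ x, MeasurableSet {t | r x t} := fun x => measurable_prodMk_left hr
  have hrank : Measurable fun x => μ {t | r t x} := measurable_measure_prodMk_right hr
  have hmeas : Measurable
      (fun x => (⟨μ.real {t | r t x}, measureReal_nonneg, measureReal_le_one⟩ : I)) :=
    hrank.ennreal_toReal.subtype_mk
  refine ⟨hmeas, ?_⟩
  have := Measure.isProbabilityMeasure_map (μ := μ) hmeas.aemeasurable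
  refine Measure.ext_of_Iic _ _ fun c => ?_
  rw [Measure.map_apply hmeas measurableSet_Iic, unitInterval.volume_Iic]
  have hset : (fun x => (⟨μ.real {t | r t x}, measureReal_nonneg, measureReal_le_one⟩ : I)) ⁻¹'
      Set.Iic c = {x | μ {t | r t x} ≤ ENNReal.ofReal c} := by
    ext x
    simp only [Set.mem_preimage, Set.mem_Iic, Set.mem_ofPred_eq]
    rw [← Subtype.coe_le_coe]
    exact (ENNReal.le_ofReal_iff_toReal_le (measure_ne_top _ _) c.2.1).symm
  rw [hset]
  refine le_antisymm (measure_rank_le_le hr htot htrans _) ?_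
  have hSm : MeasurableSet {x | μ {t | r t x} ≤ ENNReal.ofReal c} :=
    measurableSet_le hrank measurable_const
  have hcompl : μ {x | μ {t | r t x} ≤ ENNReal.ofReal c}ᶜ ≤ ENNReal.ofReal (1 - c) := by
    refine le_trans (measure_mono fun x hx => ?_) (measure_rank_le_le (μ := μ)
      (r := fun a b => r b a) (measurable_swap hr) (fun a b => htot b a)
      (fun a b c hab hbc => htrans _ _ _ hbc hab) (ENNReal.ofReal (1 - c)))
    have hx' : ENNReal.ofReal c < μ {t | r t x} := by simpa using hx
    have hun : μ {t | r t x} + μ {t | r x t} = 1 := by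
      rw [← measure_union_add_inter _ (hDm' x)]
      have h1 : {t | r t x} ∪ {t | r x t} = Set.univ := Set.eq_univ_of_forall fun t => htot t x
      have h2 : μ ({t | r t x} ∩ {t | r x t}) = 0 := hnull x
      rw [h1, h2, measure_univ, add_zero]
    have h3 : μ {t | r x t} = 1 - μ {t | r t x} := by
      rw [← hun]
      exact (ENNReal.add_sub_cancel_left (measure_ne_top _ _)).symm
    change μ {t | r x t} ≤ _
    rw [h3, ENNReal.ofReal_sub _ c.2.1, ENNReal.ofReal_one]
    exact tsub_le_tsub_left hx'.le 1
  rw [prob_compl_eq_one_sub hSm, ENNReal.ofReal_sub _ c.2.1, ENNReal.ofReal_one] at hcompl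
  have hle1 : ENNReal.ofReal c ≤ 1 := by simpa using c.2.2
  have h1 : (1 : ℝ≥0∞) ≤ 1 - ENNReal.ofReal c + μ {x | μ {t | r t x} ≤ ENNReal.ofReal c} :=
    tsub_le_iff_right.1 hcompl
  have h2 : 1 - ENNReal.ofReal c + ENNReal.ofReal c = 1 := tsub_add_cancel_of_le hle1
  have hne : 1 - ENNReal.ofReal c ≠ ∞ := ENNReal.sub_ne_top ENNReal.one_ne_top
  exact (ENNReal.add_le_add_iff_left hne).1 (h2.le.trans h1)

end Rank

/-! ### Lifting a map with given law through the quantile function -/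

theorem exists_measurePreserving_lift (ν : Measure I) :
    ∃ Q : I → I, Measurable Q ∧ ∀ φ : I → I, Measurable φ → (volume : Measure I).map φ = ν →
      ∃ ρ : I → I, MeasurePreserving ρ volume volume ∧ ∀ᵐ x, Q (ρ x) = φ x := by
  obtain ⟨D, hDc, hDd⟩ := TopologicalSpace.exists_countable_dense I
  let Q : I → I := fun u => sInf {s | s ∈ D ∧ (u : ℝ) ≤ ν.real (Set.Iic s)}
  have hQ : Monotone Q := fun u u' huu =>
    sInf_le_sInf fun s hs => ⟨hs.1, (Subtype.coe_le_coe.2 huu).trans hs.2⟩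
  refine ⟨Q, hQ.measurable, fun φ hφ hν => ?_⟩
  let r : I → I → Prop := fun t x => φ t < φ x ∨ (φ t = φ x ∧ t ≤ x)
  have hr : MeasurableSet {p : I × I | r p.1 p.2} :=
    (measurableSet_lt (hφ.comp measurable_fst) (hφ.comp measurable_snd)).union
      ((measurableSet_eq_fun (hφ.comp measurable_fst) (hφ.comp measurable_snd)).inter
        (measurableSet_le (f := fun p : I × I => p.1) (g := fun p : I × I => p.2)
          measurable_fst measurable_snd))
  have htot : ∀ a b, r a b ∨ r b a := by
    intro a b
    rcases lt_trichotomy (φ a) (φ b) with h | h | h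
    · exact Or.inl (Or.inl h)
    · rcases le_total a b with h' | h'
      · exact Or.inl (Or.inr ⟨h, h'⟩)
      · exact Or.inr (Or.inr ⟨h.symm, h'⟩)
    · exact Or.inr (Or.inl h)
  have htrans : ∀ a b c, r a b → r b c → r a c := by
    rintro a b c (h | ⟨h, h'⟩) (k | ⟨k, k'⟩)
    · exact Or.inl (h.trans k)
    · exact Or.inl (k ▸ h)
    · exact Or.inl (h ▸ k)
    · exact Or.inr ⟨h.trans k, h'.trans k'⟩
  have hnull : ∀ a, (volume : Measure I) {t | r t a ∧ r a t} = 0 := by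
    intro a
    refine measure_mono_null (t := {a}) ?_ (measure_singleton a)
    rintro t ⟨h | ⟨h, h'⟩, k | ⟨k, k'⟩⟩
    · exact absurd h (not_lt.2 k.le)
    · exact absurd k h.ne'
    · exact absurd h k.ne'
    · exact le_antisymm h' k'
  have hρ := measurePreserving_rank hr htot htrans hnull
  set ρ : I → I := fun x => ⟨(volume : Measure I).real {t | r t x}, measureReal_nonneg,
    measureReal_le_one⟩ with hρdef
  refine ⟨ρ, hρ, ?_⟩
  have hF : ∀ s : I, ν.real (Set.Iic s) = (volume : Measure I).real (φ ⁻¹' Set.Iic s) := by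
    intro s
    rw [← hν, map_measureReal_apply hφ measurableSet_Iic]
  have hae : ∀ s : I, ∀ᵐ x, φ x ≤ s ↔ (ρ x : ℝ) ≤ ν.real (Set.Iic s) := by
    intro s
    set c : I := ⟨ν.real (Set.Iic s), measureReal_nonneg, by rw [hF]; exact measureReal_le_one⟩
      with hc
    have hsub : φ ⁻¹' Set.Iic s ⊆ ρ ⁻¹' Set.Iic c := by
      intro x hx
      have hx : φ x ≤ s := hx
      change (volume : Measure I).real {t | r t x} ≤ ν.real (Set.Iic s)
      rw [hF]
      refine measureReal_mono fun t ht => ?_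
      rcases ht with h | h
      · exact h.le.trans hx
      · exact h.1.le.trans hx
    have hmeas : (volume : Measure I) (ρ ⁻¹' Set.Iic c) ≤ volume (φ ⁻¹' Set.Iic s) := by
      rw [hρ.measure_preimage measurableSet_Iic.nullMeasurableSet, unitInterval.volume_Iic]
      change ENNReal.ofReal (ν.real (Set.Iic s)) ≤ _
      rw [hF, ofReal_measureReal]
    have heq := ae_eq_of_subset_of_measure_ge hsub hmeas
      (hφ measurableSet_Iic).nullMeasurableSet (measure_ne_top _ _)
    filter_upwards [heq] with x hx
    exact (iff_of_eq hx)
  have hall : ∀ᵐ x, ∀ s ∈ D, (φ x ≤ s ↔ (ρ x : ℝ) ≤ ν.real (Set.Iic s)) :=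
    (ae_ball_iff hDc).2 fun s _ => hae s
  filter_upwards [hall] with x hx
  refine le_antisymm ?_ ?_
  · refine le_of_forall_gt_imp_ge_of_dense fun b hb => ?_
    obtain ⟨s, hsD, hs⟩ := hDd.exists_between hb
    have hmem : s ∈ {s | s ∈ D ∧ (ρ x : ℝ) ≤ ν.real (Set.Iic s)} := ⟨hsD, (hx s hsD).1 hs.1.le⟩
    exact (sInf_le hmem).trans hs.2.le
  · exact le_sInf fun s hs => (hx s hs.1).2 hs.2

/-! ### A kernel constant on the fibres of a map factors through it -/

open ProbabilityTheory in
theorem exists_factor_of_ae_eq_on_fibres {W : I → I → ℝ}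
    (hm : Measurable fun p : I × I => W p.1 p.2) (hsymm : ∀ x y, W x y = W y x) {C : ℝ}
    (hb : ∀ x y, |W x y| ≤ C) {φ : I → I} (hφ : Measurable φ)
    (hfib : ∀ x x', φ x = φ x' → ∀ᵐ y, W x y = W x' y) :
    ∃ U : SymmKernel, (Measurable fun p : I × I => U p.1 p.2) ∧ AEEqSquare W (pullback U φ) := by
  obtain ⟨κ, _, hjoint⟩ : ∃ κ : Kernel I I, IsMarkovKernel κ ∧
      (volume : Measure I).map φ ⊗ₘ κ = (volume : Measure I).map fun a => (φ a, a) :=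
    ⟨condDistrib id φ volume, inferInstance, compProd_map_condDistrib aemeasurable_id⟩
  have hWx : ∀ x, Measurable fun y => W x y := fun x => hm.comp measurable_prodMk_left
  have hWint : ∀ (ν : Measure (I × I)) [IsFiniteMeasure ν],
      Integrable (fun p : I × I => W p.1 p.2) ν := fun ν _ =>
    Integrable.of_bound hm.aestronglyMeasurable C (ae_of_all _ fun p => hb _ _)
  let u : I → I → ℝ := fun s t => ∫ a, ∫ b, W a b ∂(κ t) ∂(κ s)
  have hu : ∀ s t, u s t = ∫ p, W p.1 p.2 ∂((κ ∥ₖ κ) (s, t)) := by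
    intro s t
    rw [Kernel.parallelComp_apply]
    exact (integral_prod _ (hWint _)).symm
  have hum : Measurable fun p : I × I => u p.1 p.2 := by
    have : (fun p : I × I => u p.1 p.2) = fun p => ∫ q, W q.1 q.2 ∂((κ ∥ₖ κ) p) := by
      funext p; exact hu p.1 p.2
    rw [this]
    exact (StronglyMeasurable.integral_kernel hm.stronglyMeasurable).measurable
  have husymm : ∀ s t, u s t = u t s := by
    intro s t
    change ∫ a, ∫ b, W a b ∂(κ t) ∂(κ s) = ∫ a, ∫ b, W a b ∂(κ s) ∂(κ t)
    rw [integral_integral_swap (f := fun a b => W a b) (hWint _)]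
    simp only [hsymm]
  have hub : ∀ s t, |u s t| ≤ C := by
    intro s t
    rw [hu, ← Real.norm_eq_abs]
    refine (norm_integral_le_of_norm_le_const (ae_of_all _ fun p => hb p.1 p.2)).trans ?_
    simp
  refine ⟨⟨u, husymm, ⟨C, hub⟩, hum.nullMeasurable⟩, hum, ?_⟩
  obtain ⟨η, hη⟩ : ∃ η : Measure (I × I), η = (volume : Measure I) ⊗ₘ (κ.comap φ hφ) := ⟨_, rfl⟩
  have : IsProbabilityMeasure η := by rw [hη]; infer_instance
  have hη_ae : ∀ {p : I × I → Prop}, (∀ᵐ q ∂η, p q) → ∀ᵐ x, ∀ᵐ a ∂(κ (φ x)), p (x, a) := by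
    intro p hp
    rw [hη] at hp
    have hp' := Measure.ae_ae_of_ae_compProd hp
    simp only [Kernel.comap_apply] at hp'
    exact hp'
  have hηsnd : MeasurePreserving Prod.snd η volume := by
    refine ⟨measurable_snd, ?_⟩
    ext s hs
    have h1 := congrArg (fun ν : Measure (I × I) => ν (Prod.snd ⁻¹' s)) hjoint
    rw [Measure.map_apply (hφ.prodMk measurable_id') (measurable_snd hs),
      Measure.compProd_apply (measurable_snd hs),
      lintegral_map (Kernel.measurable_kernel_prodMk_left (measurable_snd hs)) hφ] at h1
    rw [Measure.map_apply measurable_snd hs, hη, Measure.compProd_apply (measurable_snd hs)]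
    exact h1
  have hηφ : ∀ᵐ p ∂η, φ p.1 = φ p.2 := by
    have hset : MeasurableSet {p : I × I | p.1 = φ p.2} :=
      measurableSet_eq_fun measurable_fst (hφ.comp measurable_snd)
    have h1 : ∀ᵐ p ∂((volume : Measure I).map φ ⊗ₘ κ), p.1 = φ p.2 := by
      rw [hjoint, ae_map_iff (hφ.prodMk measurable_id').aemeasurable hset]
      exact ae_of_all _ fun _ => rfl
    have h2 := Measure.ae_ae_of_ae_compProd h1
    have h3 := ae_of_ae_map hφ.aemeasurable h2
    rw [hη]
    exact Measure.ae_compProd_of_ae_ae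
      (measurableSet_eq_fun (hφ.comp measurable_fst) (hφ.comp measurable_snd)) h3
  have hηW : ∀ᵐ p ∂η, ∀ᵐ y, W p.1 y = W p.2 y := hηφ.mono fun p hp => hfib _ _ hp
  have hset1 : MeasurableSet {q : (I × I) × I | W q.1.1 q.2 = W q.1.2 q.2} :=
    measurableSet_eq_fun
      (hm.comp ((measurable_fst.comp measurable_fst).prodMk measurable_snd))
      (hm.comp ((measurable_snd.comp measurable_fst).prodMk measurable_snd))
  have hA : ∀ᵐ y, ∀ᵐ x, ∀ᵐ a ∂(κ (φ x)), W x y = W a y := by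
    have := (Measure.ae_ae_comm (p := fun (p : I × I) (y : I) => W p.1 y = W p.2 y) hset1).1 hηW
    filter_upwards [this] with y hy
    exact hη_ae hy
  have hB : ∀ᵐ y, ∀ᵐ x, ∀ᵐ a ∂(κ (φ x)), ∀ᵐ b ∂(κ (φ y)), W a y = W a b := by
    have h1 : ∀ᵐ y, ∀ᵐ b ∂(κ (φ y)), ∀ᵐ a, W y a = W b a := hη_ae hηW
    filter_upwards [h1] with y hy
    have hset2 : MeasurableSet {q : I × I | W y q.2 = W q.1 q.2} :=
      measurableSet_eq_fun ((hWx y).comp measurable_snd) hm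
    have h2 : ∀ᵐ a, ∀ᵐ b ∂(κ (φ y)), W y a = W b a :=
      (Measure.ae_ae_comm (p := fun b a : I => W y a = W b a) hset2).1 hy
    have h3 := hηsnd.quasiMeasurePreserving.ae h2
    have h4 := hη_ae h3
    filter_upwards [h4] with x hx
    filter_upwards [hx] with a ha
    filter_upwards [ha] with b hb
    rw [hsymm a y, hsymm a b]
    exact hb
  have hgoal : ∀ᵐ y, ∀ᵐ x, W x y = u (φ x) (φ y) := by
    filter_upwards [hA, hB] with y hAy hBy
    filter_upwards [hAy, hBy] with x hAx hBx
    have h1 : ∀ᵐ a ∂(κ (φ x)), ∫ b, W a b ∂(κ (φ y)) = W x y := by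
      filter_upwards [hAx, hBx] with a ha hb
      have : ∀ᵐ b ∂(κ (φ y)), W a b = W x y := hb.mono fun b hb => by rw [← hb, ha]
      rw [integral_congr_ae this]
      simp
    change _ = ∫ a, ∫ b, W a b ∂(κ (φ y)) ∂(κ (φ x))
    rw [integral_congr_ae h1]
    simp
  have hset3 : MeasurableSet {q : I × I | W q.1 q.2 = u (φ q.1) (φ q.2)} :=
    measurableSet_eq_fun hm (hum.comp ((hφ.comp measurable_fst).prodMk (hφ.comp measurable_snd)))
  have hgoal' : ∀ᵐ x, ∀ᵐ y, W x y = u (φ x) (φ y) :=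
    (Measure.ae_ae_comm (p := fun x y : I => W x y = u (φ x) (φ y)) hset3).2 hgoal
  exact (Measure.ae_prod_iff_ae_ae hset3).2 hgoal'

/-! ### From a coupling to a common factor -/

theorem exists_countable_determining_sets :
    ∃ B : ℕ → Set I, (∀ k, MeasurableSet (B k)) ∧ ∀ f g : I → ℝ, Integrable f → Integrable g →
      (∀ k, ∫ y in B k, f y = ∫ y in B k, g y) → f =ᵐ[volume] g := by
  obtain ⟨D, hDc, hDd, hDbot, -⟩ := exists_countable_dense_bot_top I
  set 𝓢 : Set (Set I) := {S | ∃ l ∈ D, ∃ u ∈ D, l < u ∧ Set.Ico l u = S} with h𝓢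
  have hgen : borel I = MeasurableSpace.generateFrom 𝓢 :=
    hDd.borel_eq_generateFrom_Ico_mem_aux hDbot fun x y hxy he =>
      absurd he (Set.nonempty_Ioo.2 hxy).ne_empty
  have hcount : 𝓢.Countable := by
    refine ((hDc.prod hDc).image fun p => Set.Ico p.1 p.2).mono ?_
    rintro _ ⟨l, hl, u, hu, -, rfl⟩
    exact ⟨(l, u), ⟨hl, hu⟩, rfl⟩
  obtain ⟨B, hB⟩ := (hcount.insert Set.univ).exists_eq_range (Set.insert_nonempty _ _)
  have hBm : ∀ k, MeasurableSet (B k) := by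
    intro k
    have : B k ∈ insert Set.univ 𝓢 := hB ▸ Set.mem_range_self k
    rcases this with h | ⟨l, -, u, -, -, h⟩
    · rw [h]; exact MeasurableSet.univ
    · rw [← h]; exact measurableSet_Ico
  refine ⟨B, hBm, fun f g hf hg h => ?_⟩
  have hS : ∀ s ∈ insert Set.univ 𝓢, ∫ y in s, f y = ∫ y in s, g y := by
    intro s hs
    rw [hB] at hs
    obtain ⟨k, rfl⟩ := hs
    exact h k
  have huniv : ∫ y, f y = ∫ y, g y := by simpa using hS Set.univ (Set.mem_insert _ _)
  refine hf.ae_eq_of_forall_setIntegral_eq f g hg fun s hs _ => ?_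
  refine MeasurableSpace.induction_on_inter
    (C := fun s _ => ∫ y in s, f y = ∫ y in s, g y)
    ((BorelSpace.measurable_eq (α := I)).trans hgen) (isPiSystem_Ico_mem D D) (by simp)
    (fun t ht => hS t (Set.mem_insert_of_mem _ ht)) ?_ ?_ s hs
  · intro t ht hfg
    have h1 := integral_add_compl ht hf
    have h2 := integral_add_compl ht hg
    linarith
  · intro t hdisj ht hfg
    rw [integral_iUnion ht hdisj hf.integrableOn, integral_iUnion ht hdisj hg.integrableOn]
    simp only [hfg]

theorem exists_common_factor_of_coupling {W W' : SymmKernel}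
    (hm : Measurable fun p : I × I => W p.1 p.2) (hm' : Measurable fun p : I × I => W' p.1 p.2)
    {γ : Measure (I × I)} [IsProbabilityMeasure γ] (hfst : MeasurePreserving Prod.fst γ volume)
    (hsnd : MeasurePreserving Prod.snd γ volume)
    (hγ : ∀ᵐ p ∂(γ.prod γ), W p.1.1 p.2.1 = W' p.1.2 p.2.2) :
    ∃ (U : SymmKernel) (φ ψ : I → I), MeasurePreserving φ volume volume ∧
      MeasurePreserving ψ volume volume ∧
      AEEqSquare W (pullback U φ) ∧ AEEqSquare W' (pullback U ψ) := by
  obtain ⟨C, hC⟩ := W.bounded'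
  obtain ⟨B, hBm, hB⟩ := exists_countable_determining_sets
  have hWx : ∀ x, Measurable fun y => W x y := fun x => hm.comp measurable_prodMk_left
  have hWi : ∀ x, Integrable fun y => W x y := fun x =>
    Integrable.of_bound (hWx x).aestronglyMeasurable C (ae_of_all _ fun y => hC x y)
  have hBi : ∀ k, Measurable ((B k).indicator (1 : I → ℝ)) := fun k =>
    measurable_one.indicator (hBm k)
  let α : I → ℕ → ℝ := fun x k => ∫ z, (B k).indicator (1 : I → ℝ) z.1 * W x z.1 ∂γ
  let β : I → ℕ → ℝ := fun x k => ∫ z, (B k).indicator (1 : I → ℝ) z.1 * W' x z.2 ∂γ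
  have hα : Measurable α := measurable_pi_iff.2 fun k => by
    have : Measurable fun q : I × (I × I) => (B k).indicator (1 : I → ℝ) q.2.1 * W q.1 q.2.1 :=
      ((hBi k).comp (measurable_fst.comp measurable_snd)).mul
        (hm.comp (measurable_fst.prodMk (measurable_fst.comp measurable_snd)))
    exact (this.stronglyMeasurable.integral_prod_right' (ν := γ)).measurable
  have hβ : Measurable β := measurable_pi_iff.2 fun k => by
    have : Measurable fun q : I × (I × I) => (B k).indicator (1 : I → ℝ) q.2.1 * W' q.1 q.2.2 :=
      ((hBi k).comp (measurable_fst.comp measurable_snd)).mul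
        (hm'.comp (measurable_fst.prodMk (measurable_snd.comp measurable_snd)))
    exact (this.stronglyMeasurable.integral_prod_right' (ν := γ)).measurable
  have hαset : ∀ x k, α x k = ∫ y in B k, W x y := by
    intro x k
    have h1 : α x k = ∫ y, (B k).indicator (1 : I → ℝ) y * W x y := by
      rw [← hfst.map_eq, integral_map measurable_fst.aemeasurable]
      exact ((hBi k).mul (hWx x)).aestronglyMeasurable
    rw [h1, ← integral_indicator (hBm k)]
    refine integral_congr_ae (ae_of_all _ fun y => ?_)
    by_cases hy : y ∈ B k <;> simp [hy]
  have hαβ : ∀ᵐ z ∂γ, α z.1 = β z.2 := by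
    filter_upwards [Measure.ae_ae_of_ae_prod hγ] with z hz
    funext k
    exact integral_congr_ae (hz.mono fun z' hz' => by simp only [hz'])
  have hnc : ¬ Countable (ℕ → ℝ) := fun _ => by
    have h1 : Function.Injective fun (t : ℝ) (_ : ℕ) => t := fun a b h => congrFun h 0
    exact (not_countable_iff.2 inferInstance : ¬ Countable ℝ) h1.countable
  have hncI : ¬ Countable I := fun _ => by
    have h1 : (volume : Measure I) Set.univ = 0 := Set.countable_univ.measure_zero _
    simp at h1
  let e : (ℕ → ℝ) ≃ᵐ I := PolishSpace.measurableEquivOfNotCountable hnc hncI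
  have hφ : Measurable fun x => e (α x) := e.measurable.comp hα
  have hψ : Measurable fun x => e (β x) := e.measurable.comp hβ
  have hlaw : (volume : Measure I).map (fun x => e (α x)) =
      (volume : Measure I).map (fun x => e (β x)) := by
    conv_lhs => rw [← hfst.map_eq]
    conv_rhs => rw [← hsnd.map_eq]
    rw [Measure.map_map hφ measurable_fst, Measure.map_map hψ measurable_snd]
    exact Measure.map_congr (hαβ.mono fun z hz => congrArg e hz)
  obtain ⟨U, hUm, hU⟩ := exists_factor_of_ae_eq_on_fibres hm W.symm' hC hφ fun x x' hxx => by
    have hxx' : α x = α x' := e.injective hxx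
    refine hB _ _ (hWi x) (hWi x') fun k => ?_
    rw [← hαset, ← hαset, hxx']
  obtain ⟨Q, hQ, hlift⟩ := exists_measurePreserving_lift ((volume : Measure I).map fun x => e (α x))
  obtain ⟨ρ, hρ, hρQ⟩ := hlift _ hφ rfl
  obtain ⟨τ, hτ, hτQ⟩ := hlift _ hψ hlaw.symm
  have hUQ : Measurable fun p : I × I => U (Q p.1) (Q p.2) :=
    hUm.comp ((hQ.comp measurable_fst).prodMk (hQ.comp measurable_snd))
  obtain ⟨K, hK⟩ := U.bounded'
  refine ⟨⟨pullback U Q, fun x y => U.symm' _ _, ⟨K, fun x y => hK _ _⟩, hUQ.nullMeasurable⟩,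
    ρ, τ, hρ, hτ, ?_, ?_⟩
  · unfold AEEqSquare at hU ⊢
    filter_upwards [hU, ae_square_of_ae hρQ] with p h1 h2
    rw [h1]
    change U (e (α p.1)) (e (α p.2)) = U (Q (ρ p.1)) (Q (ρ p.2))
    rw [h2.1, h2.2]
  · have h1 : ∀ᵐ p ∂(γ.prod γ), W p.1.1 p.2.1 = U (e (α p.1.1)) (e (α p.2.1)) :=
      (hfst.prod hfst).quasiMeasurePreserving.ae hU
    have h2 : ∀ᵐ p ∂(γ.prod γ), W' p.1.2 p.2.2 = U (e (β p.1.2)) (e (β p.2.2)) := by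
      filter_upwards [h1, hγ, Measure.quasiMeasurePreserving_fst.ae hαβ,
        Measure.quasiMeasurePreserving_snd.ae hαβ] with p h3 h4 h5 h6
      rw [← h4, h3, h5, h6]
    have hset : MeasurableSet {p : I × I | W' p.1 p.2 = U (e (β p.1)) (e (β p.2))} :=
      measurableSet_eq_fun hm'
        (hUm.comp ((hψ.comp measurable_fst).prodMk (hψ.comp measurable_snd)))
    have h3 : ∀ᵐ p ∂(volume : Measure (I × I)), W' p.1 p.2 = U (e (β p.1)) (e (β p.2)) := by
      have hmp := hsnd.prod hsnd
      change ∀ᵐ p ∂((volume : Measure I).prod volume), _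
      rw [← hmp.map_eq, ae_map_iff hmp.aemeasurable hset]
      exact h2
    unfold AEEqSquare
    filter_upwards [h3, ae_square_of_ae hτQ] with p h4 h5
    rw [h4]
    change U (e (β p.1)) (e (β p.2)) = U (Q (τ p.1)) (Q (τ p.2))
    rw [h5.1, h5.2]

/-! ### The equivalences -/

theorem AEEqSquare.ae_comp {f g : I → I → ℝ} (h : AEEqSquare f g) {Ω : Type*} [MeasurableSpace Ω]
    {ν : Measure Ω} [SFinite ν] {X : Ω → I} (hX : MeasurePreserving X ν volume) :
    ∀ᵐ p ∂(ν.prod ν), f (X p.1) (X p.2) = g (X p.1) (X p.2) :=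
  (hX.prod hX).quasiMeasurePreserving.ae h

theorem simpleDensity_eq_of_aeEqSquare {W V : SymmKernel} (h : AEEqSquare W V) {n : ℕ}
    (F : SimpleGraph (Fin n)) : simpleDensity F W = simpleDensity F V := by
  obtain ⟨F', hF'⟩ := simpleDensity_eq_multiDensity F
  rw [hF', hF']
  exact multiDensity_eq_of_coupling (MeasurePreserving.id _) (MeasurePreserving.id _) h F'

/-- The kernel `c • W`. -/
def SymmKernel.scale (c : ℝ) (W : SymmKernel) : SymmKernel where
  toFun x y := c * W x y
  symm' x y := by rw [W.symm']
  bounded' := by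
    obtain ⟨C, hC⟩ := W.bounded'
    exact ⟨|c| * C, fun x y => by
      rw [abs_mul]; exact mul_le_mul_of_nonneg_left (hC x y) (abs_nonneg c)⟩
  measurable' := (measurable_const_mul c).comp_nullMeasurable W.measurable'

open Classical in
theorem simpleDensity_scale (c : ℝ) (W : SymmKernel) {n : ℕ} (F : SimpleGraph (Fin n)) :
    simpleDensity F (W.scale c) = c ^ F.edgeFinset.card * simpleDensity F W := by
  unfold simpleDensity
  rw [← integral_const_mul]
  congr 1
  funext x
  rw [← Finset.prod_const, ← Finset.prod_mul_distrib]
  refine Finset.prod_congr rfl fun e _ => ?_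
  induction e with
  | h i j => rfl

theorem exists_coupling_of_simpleDensity_eq {W W' : SymmKernel}
    (hd : ∀ (n : ℕ) (F : SimpleGraph (Fin n)), simpleDensity F W' = simpleDensity F W) :
    ∃ γ : Measure (I × I), IsProbabilityMeasure γ ∧
      γ.map Prod.fst = (volume : Measure I) ∧ γ.map Prod.snd = (volume : Measure I) ∧
      ∀ᵐ p ∂(γ.prod γ), W p.1.1 p.2.1 = W' p.1.2 p.2.2 := by
  obtain ⟨C, hC⟩ := W.bounded'
  obtain ⟨C', hC'⟩ := W'.bounded'
  have hC0 : 0 ≤ C := (abs_nonneg _).trans (hC 0 0)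
  have hC0' : 0 ≤ C' := (abs_nonneg _).trans (hC' 0 0)
  obtain ⟨V, hVm, hVb, hV⟩ := W.exists_borel hC
  obtain ⟨V', hVm', hVb', hV'⟩ := W'.exists_borel hC'
  set c : ℝ := (C + C' + 1)⁻¹ with hc
  have hc0 : 0 < c := by positivity
  have hscale : ∀ t : ℝ, |t| ≤ C + C' → |c * t| ≤ 1 := by
    intro t ht
    rw [abs_mul, abs_of_pos hc0, hc, inv_mul_le_iff₀ (by positivity)]
    linarith
  obtain ⟨γ, hγ, h1, h2, h3⟩ := exists_coupling_of_simpleDensity_eq_of_le_one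
    (W := V.scale c) (W' := V'.scale c) (hVm.const_mul c) (hVm'.const_mul c)
    (fun x y => hscale _ ((hVb x y).trans (by linarith)))
    (fun x y => hscale _ ((hVb' x y).trans (by linarith)))
    (fun n F => by
      rw [simpleDensity_scale, simpleDensity_scale, ← simpleDensity_eq_of_aeEqSquare hV,
        ← simpleDensity_eq_of_aeEqSquare hV', hd])
  refine ⟨γ, hγ, h1, h2, ?_⟩
  filter_upwards [h3, hV.ae_comp ⟨measurable_fst, h1⟩, hV'.ae_comp ⟨measurable_snd, h2⟩]
    with p h4 h5 h6
  rw [h5, h6]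
  exact mul_left_cancel₀ hc0.ne' h4

theorem corollary2 (W W' : SymmKernel) :
    List.TFAE [
      ∀ (n : ℕ) (F : SimpleGraph (Fin n)), simpleDensity F W' = simpleDensity F W,
      ∀ (n : ℕ) (F : Multigraph (Fin n)), multiDensity F W' = multiDensity F W,
      ∃ (U : SymmKernel) (φ ψ : I → I), LebesguePreserving φ ∧ LebesguePreserving ψ ∧
        AEEqSquare W (pullback U φ) ∧ AEEqSquare W' (pullback U ψ),
      ∃ φ ψ : I → I, LebesguePreserving φ ∧ LebesguePreserving ψ ∧
        AEEqSquare (pullback W' φ) (pullback W ψ),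
      ∃ γ : Measure (I × I), IsProbabilityMeasure γ ∧
        γ.map Prod.fst = (volume : Measure I) ∧ γ.map Prod.snd = (volume : Measure I) ∧
        ∀ᵐ p ∂(γ.prod γ), W p.1.1 p.2.1 = W' p.1.2 p.2.2] := by
  have hpull : ∀ {W U : SymmKernel} {φ : I → I}, LebesguePreserving φ →
      AEEqSquare W (pullback U φ) → ∀ {n : ℕ} (F : Multigraph (Fin n)),
      multiDensity F W = multiDensity F U := by
    intro W U φ hφ h n F
    obtain ⟨φ', hφ', he⟩ := hφ.exists_measurePreserving
    refine multiDensity_eq_of_coupling (MeasurePreserving.id _) hφ' ?_ F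
    filter_upwards [h, ae_square_of_ae he] with p h1 h2
    change W p.1 p.2 = U (φ' p.1) (φ' p.2)
    rw [h1, ← h2.1, ← h2.2]
    rfl
  tfae_have 1 → 5 := exists_coupling_of_simpleDensity_eq
  tfae_have 5 → 4 := by
    rintro ⟨γ, hγ, h1, h2, h3⟩
    obtain ⟨ρ, hρ, hργ⟩ := γ.exists_measurable_map_eq
    have hmp : MeasurePreserving ρ volume γ := ⟨hρ, hργ⟩
    have hfst : MeasurePreserving Prod.fst γ volume := ⟨measurable_fst, h1⟩
    have hsnd : MeasurePreserving Prod.snd γ volume := ⟨measurable_snd, h2⟩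
    refine ⟨fun x => (ρ x).2, fun x => (ρ x).1, (hsnd.comp hmp).lebesguePreserving,
      (hfst.comp hmp).lebesguePreserving, ?_⟩
    exact ((hmp.prod hmp).quasiMeasurePreserving.ae h3).mono fun p hp => hp.symm
  tfae_have 5 → 3 := by
    rintro ⟨γ, hγ, h1, h2, h3⟩
    have hfst : MeasurePreserving Prod.fst γ volume := ⟨measurable_fst, h1⟩
    have hsnd : MeasurePreserving Prod.snd γ volume := ⟨measurable_snd, h2⟩
    obtain ⟨V, hVm, -, hV⟩ := W.exists_borel W.bounded'.choose_spec
    obtain ⟨V', hVm', -, hV'⟩ := W'.exists_borel W'.bounded'.choose_spec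
    obtain ⟨U, φ, ψ, hφ, hψ, hU, hU'⟩ := exists_common_factor_of_coupling hVm hVm' hfst hsnd (by
      filter_upwards [h3, hV.ae_comp hfst, hV'.ae_comp hsnd] with p h4 h5 h6
      rw [← h5, ← h6, h4])
    refine ⟨U, φ, ψ, hφ.lebesguePreserving, hψ.lebesguePreserving, ?_, ?_⟩
    · exact (hV.and hU).mono fun p hp => hp.1.trans hp.2
    · exact (hV'.and hU').mono fun p hp => hp.1.trans hp.2
  tfae_have 3 → 2 := by
    rintro ⟨U, φ, ψ, hφ, hψ, h, h'⟩ n F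
    rw [hpull hφ h F, hpull hψ h' F]
  tfae_have 4 → 2 := by
    rintro ⟨φ, ψ, hφ, hψ, h⟩ n F
    obtain ⟨φ', hφ', he⟩ := hφ.exists_measurePreserving
    obtain ⟨ψ', hψ', he'⟩ := hψ.exists_measurePreserving
    refine multiDensity_eq_of_coupling hφ' hψ' ?_ F
    filter_upwards [h, ae_square_of_ae he, ae_square_of_ae he'] with p h1 h2 h3
    rw [← h2.1, ← h2.2, ← h3.1, ← h3.2]
    exact h1
  tfae_have 2 → 1 := by
    intro h n F
    obtain ⟨F', hF'⟩ := simpleDensity_eq_multiDensity F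
    rw [hF', hF', h]
  tfae_finish
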